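/- Let $AP$ be a countable set. A *stochastic Markov model* (SMM) is a tuple $\mathcal M=(S,A,\tau,\rho,\ell)$ with a finite nonempty set $S$ of states, a set $A\subseteq S$ of absorbing states, a map $\tau$ assigning to every $s\in S\setminus A$ a probability distribution $\tau(s)$ on $S$, a map $\rho$ assigning to every $s\in S\setminus A$ a Borel probability measure $\rho(s)$ on $\mathbb R_{\ge 0}$, and a labelling $\ell:S\to 2^{AP}$. Write $s\equiv s'$ if $\ell(s)=\ell(s')$ and ($s\in A\iff s'\in A$). *Bisimilarity.* An equivalence relation $R$ on $S$ is a bisimulation if $(s,s')\in R$ implies $s\equiv s'$ and, when $s,s'\notin A$, also $\rho(s)=\rho(s')$ and $\tau(s)(C)=\tau(s')(C)$ for every $C\in S/R$. States $s,s'$ are bisimilar, $s\sim_{\mathcal M}s'$, if $(s,s')\in R$ for some bisimulation $R$. *Coupling models.* A coupling model $\mathcal C$ for $\mathcal M$ consists, for every pair $s,s'\in S\setminus A$, of a probability distribution $\tau'(s,s')$ on $S\times S$ with marginals $\tau(s),\tau(s')$ and a Borel probability measure $\rho'(s,s')$ on $\mathbb R_{\ge0}\times\mathbb R_{\ge0}$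 with marginals $\rho(s),\rho(s')$; its states are the pairs in $S\times S$, and its absorbing states are those in $A'=(A\times S)\cup(S\times A)$. A coupled timed path is a finite or infinite alternating sequence $x_0,t_0,x_1,t_1,x_2,\dots$ with $x_i\in S\times S$, $t_i\in\mathbb R_{\ge0}\times\mathbb R_{\ge0}$, which ends, if it is finite, in a state $x_n$. For $x\in S\times S$, $\Pr^{\mathcal C}_x$ is the unique probability measure, on the $\sigma$-algebra of sets of coupled timed paths generated by the cylinders $\mathfrak C(x_0,R_0,\dots,R_{n-1},x_n)$ (paths with at least $n$ steps whose prefix lies in $\{x_0\}\times R_0\times\dots\times R_{n-1}\times\{x_n\}$, with the $R_i$ Borel), such that $$\Pr\nolimits^{\mathcal C}_x(\mathfrak C(x_0))=\chi_{\{x\}}(x_0),\qquad \Pr\nolimits^{\mathcal C}_x(\mathfrak C(x_0,R_0,\dots,R_n,x_{n+1}))=\Pr\nolimits^{\mathcal C}_x(\mathfrak C(x_0,R_0,\dots,R_{n-1},x_n))\cdot P'(x_n,R_n,x_{n+1}),$$ where $P'(u,R,v)=\rho'(u)(R)\,\tau'(u)(v)$ if $u\notin A'$ and $P'(u,R,v)=0$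 if $u\in A'$ (so paths end exactly when they reach $A'$, almost surely). *The distance.* Let $\eta$ map a coupled timed path to the pair $(\pi,\pi')$ of its components. Write $\pi\equiv^\omega\pi'$ if $\pi$ and $\pi'$ have the same length, have equal delays, and have $\equiv$-related states at every position. Define $$\vartheta^{\mathcal M}(s,s')=\min\bigl\{\Pr\nolimits^{\mathcal C}_{(s,s')}(\eta^{-1}(\not\equiv^\omega))\;\bigm|\;\mathcal C\text{ a coupling model for }\mathcal M\bigr\}.$$ **Theorem.** Let $\mathcal M=(S,A,\tau,\rho,\ell)$ be an SMM. Then the minimum defining $\vartheta^{\mathcal M}(s,s')$ is attained for all $s,s'\in S$, and 1. $\vartheta^{\mathcal M}$ is a pseudometric on $S$: it is nonnegative, and for all $x,y,z\in S$, $\vartheta^{\mathcal M}(x,x)=0$, $\vartheta^{\mathcal M}(x,y)=\vartheta^{\mathcal M}(y,x)$ and $\vartheta^{\mathcal M}(x,z)\le\vartheta^{\mathcal M}(x,y)+\vartheta^{\mathcal M}(y,z)$; 2. for all $s,s'\in S$, $\vartheta^{\mathcal M}(s,s')=0$ if and only if $s\sim_{\mathcal M}s'$. -/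

import Mathlib

open MeasureTheory
open scoped NNReal ENNReal

noncomputable section

/-! ### Timed paths -/

/-- A (finite or infinite) timed path `x₀, t₀, x₁, t₁, x₂, …` over states `Q` with delays in `T`:
an initial state `x₀` followed by a finite or infinite sequence of steps `(tᵢ, xᵢ₊₁)`.
A finite timed path represents a run that ends because it has reached an absorbing state. -/
@[ext] structure TimedPath (Q T : Type*) where
  start : Q
  steps : Stream'.Seq (T × Q)

namespace TimedPath

variable {Q T : Type*}

/-- The state `xₖ` of the path, if the path has at least `k` steps. -/
def state (π : TimedPath Q T) : ℕ → Option Q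
  | 0 => some π.start
  | k + 1 => (π.steps.get? k).map Prod.snd

/-- The delay `tₖ` of the path, if the path has at least `k + 1` steps. -/
def time (π : TimedPath Q T) (k : ℕ) : Option T := (π.steps.get? k).map Prod.fst

/-- The cylinder `𝔠(x₀, R₀, x₁, …, Rₙ₋₁, xₙ)` of the paths that have at least `n` steps and
whose prefix of length `n` lies in `{x₀} × R₀ × {x₁} × ⋯ × Rₙ₋₁ × {xₙ}`. -/
def cylinder (x : ℕ → Q) (R : ℕ → Set T) (n : ℕ) : Set (TimedPath Q T) :=
  {π | π.start = x 0 ∧ ∀ i < n, ∃ t ∈ R i, π.steps.get? i = some (t, x (i + 1))}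

/-- The family of measurable cylinders. -/
def cylinders (Q T : Type*) [MeasurableSpace T] : Set (Set (TimedPath Q T)) :=
  {E | ∃ (x : ℕ → Q) (R : ℕ → Set T) (n : ℕ), (∀ i, MeasurableSet (R i)) ∧ E = cylinder x R n}

/-- The `σ`-algebra generated by the measurable cylinders. -/
instance [MeasurableSpace T] : MeasurableSpace (TimedPath Q T) :=
  MeasurableSpace.generateFrom (cylinders Q T)

lemma cylinder_inter {x y : ℕ → Q} {R R' : ℕ → Set T} {n m : ℕ} (hnm : n ≤ m)
    (hne : (cylinder x R n ∩ cylinder y R' m).Nonempty) :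
    cylinder x R n ∩ cylinder y R' m =
      cylinder y (fun i => if i < n then R i ∩ R' i else R' i) m := by
  obtain ⟨π, ⟨h0, h1⟩, h0', h1'⟩ := hne
  have e0 : x 0 = y 0 := h0.symm.trans h0'
  have e1 : ∀ i < n, x (i + 1) = y (i + 1) := by
    intro i hi
    obtain ⟨t, -, ht⟩ := h1 i hi
    obtain ⟨t', -, ht'⟩ := h1' i (hi.trans_le hnm)
    rw [ht] at ht'
    simp only [Option.some.injEq, Prod.mk.injEq] at ht'
    exact ht'.2
  ext σ
  constructor
  · rintro ⟨⟨-, b⟩, c, d⟩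
    refine ⟨c, fun i hi => ?_⟩
    obtain ⟨t, ht, ht'⟩ := d i hi
    refine ⟨t, ?_, ht'⟩
    by_cases hin : i < n
    · obtain ⟨u, hu, hu'⟩ := b i hin
      rw [hu'] at ht'
      simp only [Option.some.injEq, Prod.mk.injEq] at ht'
      simp only [hin, if_true]
      exact ⟨ht'.1 ▸ hu, ht⟩
    · simpa [hin] using ht
  · rintro ⟨a, b⟩
    refine ⟨⟨a.trans e0.symm, fun i hi => ?_⟩, a, fun i hi => ?_⟩
    · obtain ⟨t, ht, ht'⟩ := b i (hi.trans_le hnm)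
      simp only [hi, if_true] at ht
      exact ⟨t, ht.1, by rw [ht', e1 i hi]⟩
    · obtain ⟨t, ht, ht'⟩ := b i hi
      refine ⟨t, ?_, ht'⟩
      by_cases hin : i < n
      · simp only [hin, if_true] at ht
        exact ht.2
      · simpa [hin] using ht

lemma isPiSystem_cylinders [MeasurableSpace T] : IsPiSystem (cylinders Q T) := by
  rintro _ ⟨x, R, n, hR, rfl⟩ _ ⟨y, R', m, hR', rfl⟩ hne
  rcases le_total n m with h | h
  · rw [cylinder_inter h hne]
    refine ⟨y, _, m, fun i => ?_, rfl⟩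
    split_ifs
    · exact (hR i).inter (hR' i)
    · exact hR' i
  · rw [Set.inter_comm] at hne ⊢
    rw [cylinder_inter h hne]
    refine ⟨x, _, n, fun i => ?_, rfl⟩
    split_ifs
    · exact (hR' i).inter (hR i)
    · exact hR i

end TimedPath

/-! ### Timed chains and their path measures -/

/-- The transition structure shared by stochastic Markov models (`T = ℝ≥0`) and by coupling models
(`T = ℝ≥0 × ℝ≥0`): a set of absorbing states and, for every other state, the law `τ` of
the next state and the law `ρ` of the residence time. -/
structure TimedChain (Q T : Type*) [MeasurableSpace T] where
  absorbing : Set Q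
  τ : {q // q ∉ absorbing} → PMF Q
  ρ : {q // q ∉ absorbing} → ProbabilityMeasure T

namespace TimedChain

variable {Q T : Type*} [MeasurableSpace T]

open Classical in
/-- `P(q, R, q') = ρ(q)(R) · τ(q)(q')` if `q` is not absorbing, and `0` otherwise. -/
def stepProb (K : TimedChain Q T) (q : Q) (R : Set T) (q' : Q) : ℝ≥0∞ :=
  if h : q ∉ K.absorbing then (K.ρ ⟨q, h⟩ : Measure T) R * K.τ ⟨q, h⟩ q' else 0

open Classical in
/-- `μ` is the law of the timed path generated by `K` from the state `q`:
`μ(𝔠(x₀)) = χ_{q}(x₀)` and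
`μ(𝔠(x₀, R₀, …, xₙ, Rₙ, xₙ₊₁)) = μ(𝔠(x₀, R₀, …, xₙ)) · P(xₙ, Rₙ, xₙ₊₁)`. -/
structure IsPathMeasure (K : TimedChain Q T) (q : Q) (μ : Measure (TimedPath Q T)) : Prop where
  isProbabilityMeasure : IsProbabilityMeasure μ
  cylinder_zero : ∀ (x : ℕ → Q) (R : ℕ → Set T),
    μ (TimedPath.cylinder x R 0) = if x 0 = q then 1 else 0
  cylinder_succ : ∀ (x : ℕ → Q) (R : ℕ → Set T), (∀ i, MeasurableSet (R i)) → ∀ n : ℕ,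
    μ (TimedPath.cylinder x R (n + 1)) =
      μ (TimedPath.cylinder x R n) * K.stepProb (x n) (R n) (x (n + 1))

lemma IsPathMeasure.unique {K : TimedChain Q T} {q : Q} {μ ν : Measure (TimedPath Q T)}
    (hμ : K.IsPathMeasure q μ) (hν : K.IsPathMeasure q ν) : μ = ν := by
  have := hμ.isProbabilityMeasure
  have := hν.isProbabilityMeasure
  refine ext_of_generate_finite _ rfl TimedPath.isPiSystem_cylinders ?_ (by simp)
  rintro _ ⟨x, R, n, hR, rfl⟩
  induction n with
  | zero => rw [hμ.cylinder_zero, hν.cylinder_zero]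
  | succ n ih => rw [hμ.cylinder_succ x R hR, hν.cylinder_succ x R hR, ih]

/-! A path is sampled from independent draws: the variable with index `(n, q)` is
distributed as `ρ(q) × τ(q)` and is used if the path is in the state `q` at step `n`. -/

/-- The sample space of the independent draws. -/
abbrev Draws (K : TimedChain Q T) : Type _ := ℕ × {q // q ∉ K.absorbing} → T × Q

open Classical in
/-- The step taken from the state `q` at time `n`, if `q` is not absorbing. -/
def drawStep (K : TimedChain Q T) (ω : K.Draws) (n : ℕ) (q : Q) : Option (T × Q) :=
  if h : q ∉ K.absorbing then some (ω (n, ⟨q, h⟩)) else none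

/-- The state after `n` steps. -/
def runState (K : TimedChain Q T) (q : Q) (ω : K.Draws) : ℕ → Option Q
  | 0 => some q
  | n + 1 => ((K.runState q ω n).bind (K.drawStep ω n)).map Prod.snd

/-- The timed path determined by the draws. -/
def run (K : TimedChain Q T) (q : Q) (ω : K.Draws) : TimedPath Q T where
  start := q
  steps := ⟨fun n => (K.runState q ω n).bind (K.drawStep ω n), by
    intro n h
    have : K.runState q ω (n + 1) = none := by
      change Option.map Prod.snd ((K.runState q ω n).bind (K.drawStep ω n)) = none
      exact congrArg (Option.map Prod.snd) h
    simp [this]⟩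

lemma run_get? (K : TimedChain Q T) (q : Q) (ω : K.Draws) (n : ℕ) :
    (K.run q ω).steps.get? n = (K.runState q ω n).bind (K.drawStep ω n) := rfl

lemma run_mem_cylinder_iff (K : TimedChain Q T) (q : Q) (ω : K.Draws) (x : ℕ → Q)
    (R : ℕ → Set T) (n : ℕ) :
    K.run q ω ∈ TimedPath.cylinder x R n ↔
      q = x 0 ∧ ∀ i < n, ∃ h : x i ∉ K.absorbing, ω (i, ⟨x i, h⟩) ∈ R i ×ˢ {x (i + 1)} := by
  have key : ∀ i, K.runState q ω i = some (x i) →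
      ((∃ t ∈ R i, (K.run q ω).steps.get? i = some (t, x (i + 1))) ↔
        ∃ h : x i ∉ K.absorbing, ω (i, ⟨x i, h⟩) ∈ R i ×ˢ {x (i + 1)}) := by
    intro i hi
    rw [run_get?, hi]
    by_cases h : x i ∉ K.absorbing
    · simp only [Option.bind_some, drawStep, h, not_false_eq_true, dite_true, Option.some.injEq,
        exists_true_left, Set.mem_prod, Set.mem_singleton_iff]
      constructor
      · rintro ⟨t, ht, e⟩
        rw [e]
        exact ⟨ht, rfl⟩
      · rintro ⟨a, b⟩
        exact ⟨_, a, Prod.ext rfl b⟩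
    · simp [drawStep, h]
  have step : ∀ i, K.runState q ω i = some (x i) →
      (∃ t ∈ R i, (K.run q ω).steps.get? i = some (t, x (i + 1))) →
      K.runState q ω (i + 1) = some (x (i + 1)) := by
    rintro i - ⟨t, -, ht⟩
    rw [run_get?] at ht
    rw [runState, ht]
    rfl
  constructor
  · rintro ⟨h0, h1⟩
    have h0 : q = x 0 := h0
    refine ⟨h0, fun i hi => ?_⟩
    have : ∀ j ≤ i, K.runState q ω j = some (x j) := by
      intro j
      induction j with
      | zero => intro _; rw [← h0]; rfl
      | succ j ih => intro hj; exact step j (ih (by omega)) (h1 j (by omega))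
    exact (key i (this i le_rfl)).1 (h1 i hi)
  · rintro ⟨h0, h1⟩
    refine ⟨h0, fun i hi => ?_⟩
    have : ∀ j ≤ i, K.runState q ω j = some (x j) := by
      intro j
      induction j with
      | zero => intro _; rw [← h0]; rfl
      | succ j ih =>
        intro hj
        have hj' := ih (by omega)
        exact step j hj' ((key j hj').2 (h1 j (by omega)))
    exact (key i (this i le_rfl)).2 (h1 i hi)

theorem exists_isPathMeasure (K : TimedChain Q T) (q : Q) :
    ∃ μ : Measure (TimedPath Q T), K.IsPathMeasure q μ := by
  classical
  let _ : MeasurableSpace Q := ⊤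
  let m : ℕ × {q // q ∉ K.absorbing} → Measure (T × Q) := fun i =>
    (K.ρ i.2 : Measure T).prod (K.τ i.2).toMeasure
  have hm : ∀ i, IsProbabilityMeasure (m i) := fun i => by
    dsimp only [m]; infer_instance
  -- the preimage of a cylinder is empty or a box
  have pre : ∀ (x : ℕ → Q) (R : ℕ → Set T) (n : ℕ),
      K.run q ⁻¹' TimedPath.cylinder x R n = {ω | q = x 0 ∧ ∀ i < n,
        ∃ h : x i ∉ K.absorbing, ω (i, ⟨x i, h⟩) ∈ R i ×ˢ {x (i + 1)}} := by
    intro x R n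
    ext ω
    exact K.run_mem_cylinder_iff q ω x R n
  have meas : Measurable (K.run q) := by
    refine measurable_generateFrom ?_
    rintro _ ⟨x, R, n, hR, rfl⟩
    rw [pre]
    refine (MeasurableSet.const _).inter ?_
    have : {ω : K.Draws | ∀ i < n, ∃ h : x i ∉ K.absorbing,
        ω (i, ⟨x i, h⟩) ∈ R i ×ˢ {x (i + 1)}} = ⋂ i, ⋂ (_ : i < n),
        {ω : K.Draws | ∃ h : x i ∉ K.absorbing, ω (i, ⟨x i, h⟩) ∈ R i ×ˢ {x (i + 1)}} := by
      ext ω; simp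
    change MeasurableSet {ω : K.Draws | ∀ i < n, ∃ h : x i ∉ K.absorbing,
        ω (i, ⟨x i, h⟩) ∈ R i ×ˢ {x (i + 1)}}
    rw [this]
    refine MeasurableSet.iInter fun i => MeasurableSet.iInter fun _ => ?_
    by_cases h : x i ∉ K.absorbing
    · simp only [h, not_false_eq_true, exists_true_left]
      exact measurable_pi_apply _ ((hR i).prod MeasurableSpace.measurableSet_top)
    · simp [h]
  have mcyl : ∀ (x : ℕ → Q) (R : ℕ → Set T) (n : ℕ), (∀ i, MeasurableSet (R i)) →
      MeasurableSet (TimedPath.cylinder x R n) := fun x R n hR =>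
    MeasurableSpace.measurableSet_generateFrom ⟨x, R, n, hR, rfl⟩
  have czero : ∀ (x : ℕ → Q) (R : ℕ → Set T),
      TimedPath.cylinder x R 0 = TimedPath.cylinder x (fun _ => Set.univ) 0 := by
    intro x R; simp [TimedPath.cylinder]
  -- the measure of a cylinder in product form
  have val : ∀ (x : ℕ → Q) (R : ℕ → Set T), (∀ i, MeasurableSet (R i)) → ∀ n : ℕ,
      (Measure.infinitePi m).map (K.run q) (TimedPath.cylinder x R n) =
        (if x 0 = q then 1 else 0) *
          ∏ i ∈ Finset.range n, K.stepProb (x i) (R i) (x (i + 1)) := by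
    intro x R hR n
    rw [Measure.map_apply meas (mcyl x R n hR), pre]
    by_cases h0 : x 0 = q
    swap
    · have : ¬ q = x 0 := fun h => h0 h.symm
      simp [h0, this]
    simp only [h0, true_and, if_true, one_mul]
    by_cases hA : ∀ i < n, x i ∉ K.absorbing
    · let idx : Fin n → ℕ × {q // q ∉ K.absorbing} := fun i => (i, ⟨x i, hA i i.2⟩)
      have hinj : Function.Injective idx := fun i j hij =>
        Fin.ext (congrArg Prod.fst hij)
      have hset : {ω : K.Draws | ∀ i < n, ∃ h : x i ∉ K.absorbing,
          ω (i, ⟨x i, h⟩) ∈ R i ×ˢ {x (i + 1)}} =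
          Set.pi (Finset.univ.image idx : Finset _)
            (fun p => R p.1 ×ˢ ({x (p.1 + 1)} : Set Q)) := by
        ext ω
        simp only [Set.mem_ofPred_eq, Set.mem_pi, Finset.coe_image, Set.mem_image,
          Finset.mem_coe, Finset.mem_univ, true_and, forall_exists_index,
          forall_apply_eq_imp_iff]
        constructor
        · intro h i
          obtain ⟨_, h2⟩ := h i i.2
          exact h2
        · intro h i hi
          exact ⟨hA i hi, h ⟨i, hi⟩⟩
      rw [hset, Measure.infinitePi_pi _ (fun p _ => (hR p.1).prod MeasurableSpace.measurableSet_top),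
        Finset.prod_image (fun i _ j _ h => hinj h), ← Fin.prod_univ_eq_prod_range
          (fun i => K.stepProb (x i) (R i) (x (i + 1)))]
      refine Finset.prod_congr rfl fun i _ => ?_
      have hi : x i ∉ K.absorbing := hA i i.2
      simp only [m, idx, Measure.prod_prod, stepProb, hi, not_false_eq_true, dite_true]
      rw [PMF.toMeasure_apply_singleton _ _ MeasurableSpace.measurableSet_top]
    · push Not at hA
      obtain ⟨i, hi, hiA⟩ := hA
      rw [Finset.prod_eq_zero (Finset.mem_range.2 hi) (by simp [stepProb, hiA])]
      convert measure_empty (μ := Measure.infinitePi m)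
      rw [Set.eq_empty_iff_forall_notMem]
      intro ω h
      exact (h i hi).1 hiA
  refine ⟨(Measure.infinitePi m).map (K.run q),
    Measure.isProbabilityMeasure_map meas.aemeasurable, fun x R => ?_, fun x R hR n => ?_⟩
  · rw [czero, val x _ (fun _ => MeasurableSet.univ) 0]
    simp
  · rw [val x R hR, val x R hR, Finset.prod_range_succ, mul_assoc]

/-- The unique probability measure `Pr_q` on timed paths generated by `K` from the state `q`. -/
def pathMeasure (K : TimedChain Q T) (q : Q) : Measure (TimedPath Q T) :=
  (K.exists_isPathMeasure q).choose

lemma isPathMeasure_pathMeasure (K : TimedChain Q T) (q : Q) :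
    K.IsPathMeasure q (K.pathMeasure q) :=
  (K.exists_isPathMeasure q).choose_spec

end TimedChain

/-! ### Stochastic Markov models -/

/-- A stochastic Markov model `(S, A, τ, ρ, ℓ)` over the state set `S`, with atomic propositions
in `AP`. -/
structure SMM (S AP : Type*) extends TimedChain S ℝ≥0 where
  label : S → Set AP

namespace SMM

variable {S AP : Type*}

/-- `s ≡ s'`: same label, and either both or neither of the two states are absorbing. -/
def StateEquiv (M : SMM S AP) (s s' : S) : Prop :=
  M.label s = M.label s' ∧ (s ∈ M.absorbing ↔ s' ∈ M.absorbing)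

/-- An equivalence relation `R` on the states is a bisimulation if related states `s, s'` satisfy
`s ≡ s'` and, when they are not absorbing, `ρ(s) = ρ(s')` and `τ(s)(C) = τ(s')(C)` for every
equivalence class `C` of `R`. -/
def IsBisimulation (M : SMM S AP) (R : Setoid S) : Prop :=
  ∀ s s' : S, R s s' → M.StateEquiv s s' ∧
    ∀ (hs : s ∉ M.absorbing) (hs' : s' ∉ M.absorbing),
      M.ρ ⟨s, hs⟩ = M.ρ ⟨s', hs'⟩ ∧
      ∀ C ∈ R.classes, (M.τ ⟨s, hs⟩).toOuterMeasure C = (M.τ ⟨s', hs'⟩).toOuterMeasure C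

/-- Two states are bisimilar if they are related by some bisimulation. -/
def Bisimilar (M : SMM S AP) (s s' : S) : Prop :=
  ∃ R : Setoid S, M.IsBisimulation R ∧ R s s'

/-- The stepwise extension of `≡` to timed paths: at every position, both paths have ended or both
are still running, with `≡`-related states and equal delays. -/
def PathEquiv (M : SMM S AP) (π π' : TimedPath S ℝ≥0) : Prop :=
  ∀ k : ℕ, Option.Rel M.StateEquiv (π.state k) (π'.state k) ∧ π.time k = π'.time k

/-- A coupling model for `M`: for every pair of non-absorbing states, a coupling `τ` of the
transition probabilities and a coupling `ρ` of the residence time probabilities. -/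
structure CouplingModel (M : SMM S AP) where
  τ : (s s' : {s // s ∉ M.absorbing}) → PMF (S × S)
  τ_fst : ∀ s s', (τ s s').map Prod.fst = M.τ s
  τ_snd : ∀ s s', (τ s s').map Prod.snd = M.τ s'
  ρ : (s s' : {s // s ∉ M.absorbing}) → ProbabilityMeasure (ℝ≥0 × ℝ≥0)
  ρ_fst : ∀ s s', (ρ s s' : Measure (ℝ≥0 × ℝ≥0)).map Prod.fst = M.ρ s
  ρ_snd : ∀ s s', (ρ s s' : Measure (ℝ≥0 × ℝ≥0)).map Prod.snd = M.ρ s'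

namespace CouplingModel

variable {M : SMM S AP}

/-- The transition structure of the coupling model: its states are the pairs of states of `M`, and
its absorbing states are those in `(A × S) ∪ (S × A)`. -/
def chain (C : M.CouplingModel) : TimedChain (S × S) (ℝ≥0 × ℝ≥0) where
  absorbing := (M.absorbing ×ˢ Set.univ) ∪ (Set.univ ×ˢ M.absorbing)
  τ p := C.τ ⟨p.1.1, fun h => p.2 (Or.inl ⟨h, trivial⟩)⟩
    ⟨p.1.2, fun h => p.2 (Or.inr ⟨trivial, h⟩)⟩
  ρ p := C.ρ ⟨p.1.1, fun h => p.2 (Or.inl ⟨h, trivial⟩)⟩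
    ⟨p.1.2, fun h => p.2 (Or.inr ⟨trivial, h⟩)⟩

end CouplingModel

/-- The function `η` that decouples a coupled timed path into the pair of its components. -/
def decouple (π : TimedPath (S × S) (ℝ≥0 × ℝ≥0)) : TimedPath S ℝ≥0 × TimedPath S ℝ≥0 :=
  (⟨π.start.1, π.steps.map fun e => (e.1.1, e.2.1)⟩,
    ⟨π.start.2, π.steps.map fun e => (e.1.2, e.2.2)⟩)

/-- The discrepancy `(Pr_{(s,s')} # η)(≢)`: the probability that the coupled path started at
`(s, s')` decouples into two paths that are not equivalent. -/
def CouplingModel.discrepancy {M : SMM S AP} (C : M.CouplingModel) (s s' : S) : ℝ :=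
  (C.chain.pathMeasure (s, s')).real (decouple ⁻¹' {p | ¬ M.PathEquiv p.1 p.2})

/-- The distance `ϑ^M`: the minimal discrepancy over all coupling models. -/
def theta (M : SMM S AP) (s s' : S) : ℝ := ⨅ C : M.CouplingModel, C.discrepancy s s'

end SMM

/-- `d` is a pseudometric on `X`. -/
structure IsPseudometric {X : Type*} (d : X → X → ℝ) : Prop where
  nonneg : ∀ x y, 0 ≤ d x y
  self : ∀ x, d x x = 0
  symm : ∀ x y, d x y = d y x
  triangle : ∀ x y z, d x z ≤ d x y + d y z

end

/-!
The proof describes the discrepancy `δ_C` of a coupling model `C` by first-step analysis. Let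
`stepLoss ν ω d = 1 - (1 - ν(≠)) (1 - E_ω d)`, where `ν(≠)` is the probability that the two delays
differ. By the Markov property of the path measure (`TimedChain.pathMeasure_of_notMem`), `δ_C` is
the least function `d` with values in `[0, 1]` that is `1` at inequivalent states and dominates
`stepLoss` for `d` and the couplings of `C` at every pair of equivalent non-absorbing states
(`CouplingModel.discrepancy_eq_stepLoss`, `CouplingModel.discrepancy_le`).

* Minima. For every cost `d`, each pair of states has couplings that minimize the step loss for
  `d`: the couplings of two distributions on a finite set are compact
  (`PMF.exists_isCoupling_isMinOn`), and a Hahn decomposition yields a maximal coupling of the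
  delays (`ProbabilityMeasure.exists_isCoupling_mismatch_le`). Choosing optimal couplings for the
  cost `ϑ = inf_C δ_C` gives a model `C` with `stepLoss ϑ ≤ ϑ`, hence with `δ_C ≤ ϑ`
  (`SMM.exists_discrepancy_eq_theta`). No continuity of the step operator is needed.
* Upper bounds. As a consequence, `ϑ ≤ d` whenever `d` dominates at every pair the step loss of
  some coupling (`SMM.theta_le`). Symmetry, the triangle inequality and `ϑ = 0` at bisimilar states
  all follow from this for a suitable `d`: the transpose of `ϑ`, the cut-off inf-convolution of `ϑ`
  with itself, and the indicator of the complement of a bisimulation. The last two rest on gluing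
  (`PMF.exists_gluing`).
* Conversely, `ϑ` is itself a fixed point, so at distance zero an optimal coupling has equal delays
  almost surely and its successors are at distance zero: `ϑ = 0` is a bisimulation.
-/

/-! ### Couplings of distributions on finite sets -/

namespace PMF

variable {α β γ : Type*}

/-- The expectation of a real function on a finite type. -/
noncomputable def expect [Fintype α] (p : PMF α) (f : α → ℝ) : ℝ := ∑ a, (p a).toReal * f a

lemma sum_toReal [Fintype α] (p : PMF α) : ∑ a, (p a).toReal = 1 := by
  rw [← ENNReal.toReal_sum fun a _ => p.apply_ne_top a, ← tsum_fintype (L := .unconditional α),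
    p.tsum_coe, ENNReal.toReal_one]

lemma expect_mono [Fintype α] (p : PMF α) {f g : α → ℝ} (h : ∀ a, f a ≤ g a) :
    p.expect f ≤ p.expect g :=
  Finset.sum_le_sum fun a _ => mul_le_mul_of_nonneg_left (h a) ENNReal.toReal_nonneg

lemma expect_nonneg [Fintype α] (p : PMF α) {f : α → ℝ} (h : ∀ a, 0 ≤ f a) : 0 ≤ p.expect f :=
  Finset.sum_nonneg fun a _ => mul_nonneg ENNReal.toReal_nonneg (h a)

lemma expect_one_sub [Fintype α] (p : PMF α) (f : α → ℝ) :
    p.expect (fun a => 1 - f a) = 1 - p.expect f := by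
  simp [expect, mul_sub, Finset.sum_sub_distrib, p.sum_toReal]

lemma expect_le_one [Fintype α] (p : PMF α) {f : α → ℝ} (h : ∀ a, f a ≤ 1) : p.expect f ≤ 1 := by
  have := p.expect_nonneg (f := fun a => 1 - f a) fun a => sub_nonneg.2 (h a)
  rw [expect_one_sub] at this
  linarith

lemma expect_add [Fintype α] (p : PMF α) (f g : α → ℝ) :
    p.expect (fun a => f a + g a) = p.expect f + p.expect g := by
  simp [expect, mul_add, Finset.sum_add_distrib]

lemma expect_eq_zero_iff [Fintype α] (p : PMF α) {f : α → ℝ} (h : ∀ a, 0 ≤ f a) :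
    p.expect f = 0 ↔ ∀ a ∈ p.support, f a = 0 := by
  rw [expect, Finset.sum_eq_zero_iff_of_nonneg
    fun a _ => mul_nonneg ENNReal.toReal_nonneg (h a)]
  refine forall_congr' fun a => ?_
  simp only [Finset.mem_univ, true_imp_iff, mul_eq_zero, ENNReal.toReal_eq_zero_iff,
    p.apply_ne_top a, or_false, mem_support_iff]
  tauto

lemma map_apply_fintype [Fintype α] [DecidableEq β] (p : PMF α) (g : α → β) (b : β) :
    p.map g b = ∑ a, if b = g a then p a else 0 := by
  classical
  rw [map_apply, tsum_fintype]
  exact Finset.sum_congr rfl fun a _ => by congr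

lemma expect_map [Fintype α] [Fintype β] (p : PMF α) (g : α → β) (f : β → ℝ) :
    (p.map g).expect f = p.expect fun a => f (g a) := by
  classical
  simp only [expect, map_apply_fintype]
  have h : ∀ b, (∑ a, if b = g a then p a else 0).toReal * f b =
      ∑ a, if b = g a then (p a).toReal * f (g a) else 0 := fun b => by
    rw [ENNReal.toReal_sum (fun a _ => by split_ifs <;> simp [p.apply_ne_top]), Finset.sum_mul]
    refine Finset.sum_congr rfl fun a _ => ?_
    split_ifs with h <;> simp [h]
  rw [Finset.sum_congr rfl fun b _ => h b, Finset.sum_comm]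
  exact Finset.sum_congr rfl fun a _ => by simp

/-- The distribution `ω` on pairs has marginals `μ` and `ν`. -/
structure IsCoupling (ω : PMF (α × β)) (μ : PMF α) (ν : PMF β) : Prop where
  fst : ω.map Prod.fst = μ
  snd : ω.map Prod.snd = ν

lemma map_fst_apply [Fintype α] [Fintype β] (ω : PMF (α × β)) (a : α) :
    ω.map Prod.fst a = ∑ b, ω (a, b) := by
  classical
  rw [map_apply_fintype, Fintype.sum_prod_type, Finset.sum_eq_single a]
  · simp
  · intro a' _ h; simp [h.symm]
  · simp

lemma map_snd_apply [Fintype α] [Fintype β] (ω : PMF (α × β)) (b : β) :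
    ω.map Prod.snd b = ∑ a, ω (a, b) := by
  classical
  rw [map_apply_fintype, Fintype.sum_prod_type_right, Finset.sum_eq_single b]
  · simp
  · intro b' _ h; simp [h.symm]
  · simp

lemma IsCoupling.swap {ω : PMF (α × β)} {μ : PMF α} {ν : PMF β} (h : ω.IsCoupling μ ν) :
    (ω.map Prod.swap).IsCoupling ν μ :=
  ⟨by rw [map_comp]; exact h.snd, by rw [map_comp]; exact h.fst⟩

/-- Two joint distributions with a common marginal are glued along it: given the common
coordinate, the other two coordinates are drawn independently. -/
theorem exists_gluing [Fintype α] [Fintype β] [Fintype γ] (p : PMF (α × β)) (q : PMF (β × γ))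
    (h : p.map Prod.snd = q.map Prod.fst) :
    ∃ r : PMF (α × β × γ), r.map (fun x => (x.1, x.2.1)) = p ∧ r.map Prod.snd = q := by
  classical
  set m : PMF β := p.map Prod.snd with hm
  have hp : ∀ a b, m b = 0 → p (a, b) = 0 := fun a b hb => by
    rw [hm, map_snd_apply, Finset.sum_eq_zero_iff] at hb
    exact hb a (Finset.mem_univ _)
  have hq : ∀ b c, m b = 0 → q (b, c) = 0 := fun b c hb => by
    rw [h, map_fst_apply, Finset.sum_eq_zero_iff] at hb
    exact hb c (Finset.mem_univ _)
  let w : α × β × γ → ℝ≥0∞ := fun x => p (x.1, x.2.1) * q x.2 / m x.2.1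
  have w1 : ∀ a b, ∑ c, w (a, b, c) = p (a, b) := fun a b => by
    simp only [w, ENNReal.div_eq_inv_mul, ← Finset.mul_sum]
    rw [← map_fst_apply, ← h]
    by_cases hb : m b = 0
    · simp [hb, hp a b hb]
    · rw [mul_comm (p _), ← mul_assoc, ENNReal.inv_mul_cancel hb (m.apply_ne_top b), one_mul]
  have w2 : ∀ b c, ∑ a, w (a, b, c) = q (b, c) := fun b c => by
    simp only [w, ENNReal.div_eq_inv_mul, ← Finset.mul_sum, ← Finset.sum_mul]
    rw [← map_snd_apply, ← hm]
    by_cases hb : m b = 0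
    · simp [hb, hq b c hb]
    · rw [← mul_assoc, ENNReal.inv_mul_cancel hb (m.apply_ne_top b), one_mul]
  have w3 : ∑ x, w x = 1 := by
    rw [Fintype.sum_prod_type, ← p.tsum_coe, tsum_fintype, Fintype.sum_prod_type]
    refine Finset.sum_congr rfl fun a _ => ?_
    rw [Fintype.sum_prod_type]
    exact Finset.sum_congr rfl fun b _ => w1 a b
  refine ⟨PMF.ofFintype w w3, ?_, ?_⟩
  · ext ⟨a, b⟩
    rw [map_apply_fintype, ← w1, Fintype.sum_prod_type, Finset.sum_eq_single a _ (by simp),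
      Fintype.sum_prod_type, Finset.sum_eq_single b _ (by simp)]
    · simp
    · intro b' _ hb; simp [hb.symm]
    · intro a' _ ha; simp [ha.symm]
  · ext x
    rw [map_snd_apply]
    exact w2 _ _

/-- Gluing two couplings yields a coupling of the outer marginals whose cost, for costs related by
a triangle inequality, is at most the sum of the two costs. -/
theorem exists_isCoupling_expect_le_add [Fintype α] [Fintype β] [Fintype γ] {p : PMF (α × β)}
    {q : PMF (β × γ)} {μ : PMF α} {κ : PMF β} {ν : PMF γ}
    (hp : p.IsCoupling μ κ) (hq : q.IsCoupling κ ν) {d : α × γ → ℝ} {f : α × β → ℝ}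
    {g : β × γ → ℝ} (hd : ∀ a b c, d (a, c) ≤ f (a, b) + g (b, c)) :
    ∃ r : PMF (α × γ), r.IsCoupling μ ν ∧ r.expect d ≤ p.expect f + q.expect g := by
  obtain ⟨r, rfl, rfl⟩ := exists_gluing p q (hp.snd.trans hq.fst.symm)
  refine ⟨r.map fun x => (x.1, x.2.2), ⟨?_, ?_⟩, ?_⟩
  · rw [← hp.fst, map_comp, map_comp]; rfl
  · rw [← hq.snd, map_comp, map_comp]; rfl
  · rw [expect_map, expect_map, expect_map, ← expect_add]
    exact expect_mono _ fun x => hd _ _ _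

/-- Distributions that give the same mass to every class of an equivalence relation have
a coupling that is supported on the relation. -/
theorem exists_isCoupling_support_subset [Fintype α] (R : Setoid α) (μ ν : PMF α)
    (h : ∀ C ∈ R.classes, μ.toOuterMeasure C = ν.toOuterMeasure C) :
    ∃ ω : PMF (α × α), ω.IsCoupling μ ν ∧ ∀ p ∈ ω.support, R p.1 p.2 := by
  classical
  have hmap : μ.map (Quotient.mk R) = ν.map (Quotient.mk R) := by
    ext c
    rw [← toOuterMeasure_apply_singleton, ← toOuterMeasure_apply_singleton,
      toOuterMeasure_map_apply, toOuterMeasure_map_apply]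
    induction c using Quotient.inductionOn with | h a => ?_
    refine h _ ⟨a, ?_⟩
    ext x
    simp only [Set.mem_preimage, Set.mem_singleton_iff, Quotient.eq, Set.mem_ofPred_eq]
  -- the two distributions are glued along the class
  obtain ⟨r, h1, h2⟩ := exists_gluing (μ.map fun a => (a, Quotient.mk R a))
    (ν.map fun a => (Quotient.mk R a, a)) (by rw [map_comp, map_comp]; exact hmap)
  refine ⟨r.map fun x => (x.1, x.2.2), ⟨?_, ?_⟩, ?_⟩
  · have := congrArg (PMF.map Prod.fst) h1
    rw [map_comp, map_comp] at this
    rw [map_comp]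
    exact this.trans μ.map_id
  · have := congrArg (PMF.map Prod.snd) h2
    rw [map_comp, map_comp] at this
    rw [map_comp]
    exact this.trans ν.map_id
  · rintro p hp
    rw [support_map] at hp
    obtain ⟨⟨a, c, b⟩, hx, rfl⟩ := hp
    have e1 : (a, c) ∈ (μ.map fun a => (a, Quotient.mk R a)).support := by
      rw [← h1, support_map]; exact ⟨_, hx, rfl⟩
    have e2 : (c, b) ∈ (ν.map fun a => (Quotient.mk R a, a)).support := by
      rw [← h2, support_map]; exact ⟨_, hx, rfl⟩
    rw [support_map] at e1 e2
    obtain ⟨a', -, e1⟩ := e1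
    obtain ⟨b', -, e2⟩ := e2
    simp only [Prod.mk.injEq] at e1 e2
    refine Quotient.exact (s := R) ?_
    rw [← e1.1, ← e2.2, e1.2, e2.1]

/-- The couplings of two distributions on finite types form a compact set, so that every cost
function has an optimal coupling. -/
theorem exists_isCoupling_isMinOn [Fintype α] [Fintype β] (μ : PMF α) (ν : PMF β)
    (d : α × β → ℝ) :
    ∃ ω : PMF (α × β), ω.IsCoupling μ ν ∧
      ∀ ω' : PMF (α × β), ω'.IsCoupling μ ν → ω.expect d ≤ ω'.expect d := by
  classical
  let K : Set (α × β → ℝ) := stdSimplex ℝ (α × β) ∩ {w | (∀ a, ∑ b, w (a, b) = (μ a).toReal) ∧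
    ∀ b, ∑ a, w (a, b) = (ν b).toReal}
  have hK : IsCompact K := by
    refine (isCompact_stdSimplex ℝ _).inter_right ?_
    simp only [Set.ofPred_and, Set.ofPred_forall]
    refine (isClosed_iInter fun a => isClosed_eq ?_ continuous_const).inter
      (isClosed_iInter fun b => isClosed_eq ?_ continuous_const) <;> fun_prop
  have mem : ∀ ω : PMF (α × β), ω.IsCoupling μ ν → (fun p => (ω p).toReal) ∈ K := fun ω h => by
    refine ⟨⟨fun _ => ENNReal.toReal_nonneg, ω.sum_toReal⟩, fun a => ?_, fun b => ?_⟩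
    · rw [← h.fst, map_fst_apply, ENNReal.toReal_sum fun b _ => ω.apply_ne_top _]
    · rw [← h.snd, map_snd_apply, ENNReal.toReal_sum fun b _ => ω.apply_ne_top _]
  -- the product coupling
  have hne : K.Nonempty := by
    refine ⟨_, mem (μ.bind fun a => ν.map (Prod.mk a)) ⟨?_, ?_⟩⟩
    · rw [map_bind]
      simp only [map_comp]
      exact (congrArg μ.bind (funext fun a => ν.map_const a)).trans μ.bind_pure
    · rw [map_bind]
      simp only [map_comp]
      exact (congrArg μ.bind (funext fun a => ν.map_id)).trans (μ.bind_const ν)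
  obtain ⟨w, ⟨hw, hw1, hw2⟩, hmin⟩ := hK.exists_isMinOn hne
    (f := fun w => ∑ p, w p * d p) (by fun_prop)
  have hsum : ∑ p, ENNReal.ofReal (w p) = 1 := by
    rw [← ENNReal.ofReal_sum_of_nonneg fun p _ => hw.1 p, hw.2, ENNReal.ofReal_one]
  refine ⟨PMF.ofFintype _ hsum, ⟨?_, ?_⟩, fun ω' h' => ?_⟩
  · ext a
    rw [map_fst_apply]
    simp only [ofFintype_apply]
    rw [← ENNReal.ofReal_sum_of_nonneg fun p _ => hw.1 _, hw1,
      ENNReal.ofReal_toReal (μ.apply_ne_top a)]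
  · ext b
    rw [map_snd_apply]
    simp only [ofFintype_apply]
    rw [← ENNReal.ofReal_sum_of_nonneg fun p _ => hw.1 _, hw2,
      ENNReal.ofReal_toReal (ν.apply_ne_top b)]
  · refine le_trans (le_of_eq ?_) (hmin (mem ω' h'))
    exact Finset.sum_congr rfl fun p _ => by rw [ofFintype_apply, ENNReal.toReal_ofReal (hw.1 p)]

end PMF

/-! ### Maximal couplings of probability measures -/

namespace MeasureTheory.ProbabilityMeasure

variable {T : Type*} [MeasurableSpace T]

/-- The probability measure `ω` on `T × T` has marginals `μ` and `ν`. -/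
structure IsCoupling (ω : ProbabilityMeasure (T × T)) (μ ν : ProbabilityMeasure T) : Prop where
  fst : (ω : Measure (T × T)).map Prod.fst = μ
  snd : (ω : Measure (T × T)).map Prod.snd = ν

/-- The probability that the two coordinates differ. -/
noncomputable def mismatch (ω : ProbabilityMeasure (T × T)) : ℝ :=
  (ω : Measure (T × T)).real (Set.diagonal T)ᶜ

lemma mismatch_nonneg (ω : ProbabilityMeasure (T × T)) : 0 ≤ ω.mismatch := measureReal_nonneg

lemma mismatch_le_one (ω : ProbabilityMeasure (T × T)) : ω.mismatch ≤ 1 := measureReal_le_one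

lemma exists_isCoupling_swap [MeasurableEq T] {ω : ProbabilityMeasure (T × T)}
    {μ ν : ProbabilityMeasure T} (h : ω.IsCoupling μ ν) :
    ∃ ω' : ProbabilityMeasure (T × T), ω'.IsCoupling ν μ ∧ ω'.mismatch = ω.mismatch := by
  refine ⟨ω.map measurable_swap.aemeasurable, ⟨?_, ?_⟩, ?_⟩
  · rw [toMeasure_map, Measure.map_map measurable_fst measurable_swap]; exact h.snd
  · rw [toMeasure_map, Measure.map_map measurable_snd measurable_swap]; exact h.fst
  · rw [mismatch, toMeasure_map, map_measureReal_apply measurable_swap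
      measurableSet_diagonal.compl, mismatch]
    congr 1
    ext p
    simp [eq_comm]

/-- The difference of the masses of a set is at most the mismatch of any coupling. -/
lemma IsCoupling.sub_le_mismatch {ω : ProbabilityMeasure (T × T)} {μ ν : ProbabilityMeasure T}
    (h : ω.IsCoupling μ ν) {B : Set T} (hB : MeasurableSet B) :
    (μ : Measure T).real B - (ν : Measure T).real B ≤ ω.mismatch := by
  rw [← h.fst, ← h.snd, map_measureReal_apply measurable_fst hB,
    map_measureReal_apply measurable_snd hB, sub_le_iff_le_add]
  refine (measureReal_mono ?_).trans (measureReal_union_le _ _)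
  rintro ⟨s, t⟩ hs
  by_cases hst : s = t
  · exact Or.inr (by subst hst; exact hs)
  · exact Or.inl hst

/-- There is a coupling whose mismatch is the total variation distance `μ(P) - ν(P)`, where `P` is
the positive set of a Hahn decomposition: the common part of `μ` and `ν` is put on the diagonal,
and the rest is coupled independently. -/
theorem exists_isCoupling_mismatch_le [MeasurableEq T] (μ ν : ProbabilityMeasure T) :
    ∃ ω : ProbabilityMeasure (T × T), ω.IsCoupling μ ν ∧ ∃ P : Set T, MeasurableSet P ∧
      ω.mismatch ≤ (μ : Measure T).real P - (ν : Measure T).real P := by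
  obtain ⟨P, hP, h1, h2⟩ := hahn_decomposition (μ : Measure T) (ν : Measure T)
  let κ : Measure T := (μ : Measure T).restrict Pᶜ + (ν : Measure T).restrict P
  have hκμ : κ ≤ μ := by
    rw [← Measure.restrict_compl_add_restrict (μ := (μ : Measure T)) hP]
    refine add_le_add_right (Measure.le_iff.2 fun t ht => ?_) _
    rw [Measure.restrict_apply ht, Measure.restrict_apply ht]
    exact h1 _ (ht.inter hP) Set.inter_subset_right
  have hκν : κ ≤ ν := by
    rw [← Measure.restrict_compl_add_restrict (μ := (ν : Measure T)) hP]
    refine add_le_add_left (Measure.le_iff.2 fun t ht => ?_) _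
    rw [Measure.restrict_apply ht, Measure.restrict_apply ht]
    exact h2 _ (ht.inter hP.compl) Set.inter_subset_right
  have : IsFiniteMeasure κ := isFiniteMeasure_of_le _ hκμ
  let μ' : Measure T := μ - κ
  let ν' : Measure T := ν - κ
  have hμ' : μ' + κ = μ := Measure.sub_add_cancel_of_le hκμ
  have hν' : ν' + κ = ν := Measure.sub_add_cancel_of_le hκν
  set m : ℝ≥0∞ := 1 - κ Set.univ with hm
  have hmμ : μ' Set.univ = m := by
    rw [Measure.sub_apply MeasurableSet.univ hκμ, measure_univ]
  have hmν : ν' Set.univ = m := by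
    rw [Measure.sub_apply MeasurableSet.univ hκν, measure_univ]
  have hm_top : m ≠ ∞ := (tsub_le_self.trans_lt ENNReal.one_lt_top).ne
  let ω : Measure (T × T) := m⁻¹ • μ'.prod ν' + κ.map fun t => (t, t)
  have hdiag : Measurable fun t : T => (t, t) := measurable_id.prodMk measurable_id
  have key : ∀ η : Measure T, η Set.univ = m → m⁻¹ • m • η = η := fun η hη => by
    by_cases h0 : m = 0
    · rw [h0, Measure.measure_univ_eq_zero] at hη
      simp [hη]
    · rw [smul_smul, ENNReal.inv_mul_cancel h0 hm_top, one_smul]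
  have fst : ω.map Prod.fst = μ := by
    rw [Measure.map_add _ _ measurable_fst, Measure.map_smul, Measure.map_fst_prod, hmν, key _ hmμ,
      Measure.map_map measurable_fst hdiag]
    exact (congrArg (μ' + ·) Measure.map_id).trans hμ'
  have snd : ω.map Prod.snd = ν := by
    rw [Measure.map_add _ _ measurable_snd, Measure.map_smul, Measure.map_snd_prod, hmμ, key _ hmν,
      Measure.map_map measurable_snd hdiag]
    exact (congrArg (ν' + ·) Measure.map_id).trans hν'
  have hω : IsProbabilityMeasure ω := ⟨by
    have := congrArg (fun η : Measure T => η Set.univ) fst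
    simpa [Measure.map_apply measurable_fst MeasurableSet.univ] using this⟩
  refine ⟨⟨ω, hω⟩, ⟨fst, snd⟩, P, hP, ?_⟩
  have hoff : ω (Set.diagonal T)ᶜ ≤ m := by
    have e : (κ.map fun t => (t, t)) (Set.diagonal T)ᶜ = 0 := by
      rw [Measure.map_apply hdiag measurableSet_diagonal.compl]
      convert measure_empty (μ := κ)
      ext t; simp
    rw [Measure.add_apply, e, add_zero]
    refine (measure_mono (Set.subset_univ _)).trans ?_
    rw [Measure.smul_apply, ← Set.univ_prod_univ, Measure.prod_prod, hmμ, hmν, smul_eq_mul,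
      ← mul_assoc]
    exact mul_le_of_le_one_left' (ENNReal.inv_mul_le_one m)
  have hκ : κ.real Set.univ = (μ : Measure T).real Pᶜ + (ν : Measure T).real P := by
    rw [measureReal_add_apply, measureReal_restrict_apply_univ, measureReal_restrict_apply_univ]
  have hreal : m.toReal = 1 - κ.real Set.univ := by
    rw [hm, ENNReal.toReal_sub_of_le ((hκμ _).trans_eq measure_univ) ENNReal.one_ne_top,
      ENNReal.toReal_one, measureReal_def]
  refine (ENNReal.toReal_mono hm_top hoff).trans ?_
  rw [hreal, hκ, probReal_compl_eq_one_sub hP]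
  linarith

/-- Every pair of probability measures has a coupling of minimal mismatch. -/
theorem exists_isCoupling_mismatch_isMin [MeasurableEq T] (μ ν : ProbabilityMeasure T) :
    ∃ ω : ProbabilityMeasure (T × T), ω.IsCoupling μ ν ∧
      ∀ ω' : ProbabilityMeasure (T × T), ω'.IsCoupling μ ν → ω.mismatch ≤ ω'.mismatch := by
  obtain ⟨ω, hω, P, hP, h⟩ := exists_isCoupling_mismatch_le μ ν
  exact ⟨ω, hω, fun ω' h' => h.trans (h'.sub_le_mismatch hP)⟩

/-- Maximal couplings make the mismatch of couplings satisfy a triangle inequality. -/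
theorem exists_isCoupling_mismatch_le_add [MeasurableEq T] {ω₁ ω₂ : ProbabilityMeasure (T × T)}
    {μ κ ν : ProbabilityMeasure T} (h₁ : ω₁.IsCoupling μ κ) (h₂ : ω₂.IsCoupling κ ν) :
    ∃ ω : ProbabilityMeasure (T × T), ω.IsCoupling μ ν ∧
      ω.mismatch ≤ ω₁.mismatch + ω₂.mismatch := by
  obtain ⟨ω, hω, P, hP, h⟩ := exists_isCoupling_mismatch_le μ ν
  refine ⟨ω, hω, ?_⟩
  linarith [h₁.sub_le_mismatch hP, h₂.sub_le_mismatch hP]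

lemma exists_isCoupling_self [MeasurableEq T] (μ : ProbabilityMeasure T) :
    ∃ ω : ProbabilityMeasure (T × T), ω.IsCoupling μ μ ∧ ω.mismatch = 0 := by
  obtain ⟨ω, hω, P, hP, h⟩ := exists_isCoupling_mismatch_le μ μ
  exact ⟨ω, hω, le_antisymm (by simpa using h) ω.mismatch_nonneg⟩

lemma IsCoupling.eq_of_mismatch_eq_zero {ω : ProbabilityMeasure (T × T)}
    {μ ν : ProbabilityMeasure T} (h : ω.IsCoupling μ ν) (h0 : ω.mismatch = 0) : μ = ν := by
  rw [mismatch, measureReal_eq_zero_iff] at h0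
  apply Subtype.ext
  refine h.fst.symm.trans ((Measure.map_congr ?_).trans h.snd)
  filter_upwards [compl_mem_ae_iff.2 h0] with p hp
  simpa using hp

end MeasureTheory.ProbabilityMeasure

/-! ### First-step analysis of the path measure -/

namespace TimedPath

variable {Q T : Type*}

/-- The path that makes the step with delay `t` from `q` to the start of `π` and continues
with `π`. -/
def cons (q : Q) (t : T) (π : TimedPath Q T) : TimedPath Q T :=
  ⟨q, Stream'.Seq.cons (t, π.start) π.steps⟩

lemma state_cons_zero (q : Q) (t : T) (π : TimedPath Q T) : (cons q t π).state 0 = some q := rfl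

lemma state_cons_succ (q : Q) (t : T) (π : TimedPath Q T) (k : ℕ) :
    (cons q t π).state (k + 1) = π.state k := by
  cases k <;> simp [cons, state]

lemma time_cons_zero (q : Q) (t : T) (π : TimedPath Q T) : (cons q t π).time 0 = some t := by
  simp [cons, time]

lemma time_cons_succ (q : Q) (t : T) (π : TimedPath Q T) (k : ℕ) :
    (cons q t π).time (k + 1) = π.time k := by
  simp [cons, time]

lemma cons_mem_cylinder_succ (q : Q) (t : T) (π : TimedPath Q T) (x : ℕ → Q) (R : ℕ → Set T)
    (n : ℕ) : cons q t π ∈ cylinder x R (n + 1) ↔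
      q = x 0 ∧ t ∈ R 0 ∧ π ∈ cylinder (fun i => x (i + 1)) (fun i => R (i + 1)) n := by
  have h0 : (∃ t' ∈ R 0, (cons q t π).steps.get? 0 = some (t', x (0 + 1))) ↔
      t ∈ R 0 ∧ π.start = x (0 + 1) := by
    simp only [cons, Stream'.Seq.get?_cons_zero, Option.some.injEq, Prod.mk.injEq]
    constructor
    · rintro ⟨_, h, rfl, h'⟩; exact ⟨h, h'⟩
    · rintro ⟨h, h'⟩; exact ⟨t, h, rfl, h'⟩
  change (q = x 0 ∧ ∀ i < n + 1, ∃ t' ∈ R i, (cons q t π).steps.get? i = some (t', x (i + 1))) ↔ _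
  rw [Nat.forall_lt_succ_left, h0]
  change (_ ∧ (_ ∧ _) ∧ _) ↔ (_ ∧ _ ∧ _ ∧ _)
  rw [and_assoc]
  simp [cons]

lemma cylinder_zero_eq (x : ℕ → Q) (R R' : ℕ → Set T) : cylinder x R 0 = cylinder x R' 0 := by
  simp [cylinder]

/-- The paths all of whose states up to step `n` lie in `D` and whose delays before step `n` lie
in `Δ`, as far as these exist. -/
def safe (D : Set Q) (Δ : Set T) (n : ℕ) : Set (TimedPath Q T) :=
  {π | (∀ k ≤ n, ∀ q ∈ π.state k, q ∈ D) ∧ ∀ k < n, ∀ t ∈ π.time k, t ∈ Δ}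

lemma safe_antitone (D : Set Q) (Δ : Set T) : Antitone (safe D Δ) := fun _ _ h _ hπ =>
  ⟨fun k hk => hπ.1 k (hk.trans h), fun k hk => hπ.2 k (hk.trans_le h)⟩

lemma cons_mem_safe_succ (q : Q) (t : T) (π : TimedPath Q T) (D : Set Q) (Δ : Set T) (n : ℕ) :
    cons q t π ∈ safe D Δ (n + 1) ↔ q ∈ D ∧ t ∈ Δ ∧ π ∈ safe D Δ n := by
  have h1 : (∀ k ≤ n + 1, ∀ q' ∈ (cons q t π).state k, q' ∈ D) ↔
      q ∈ D ∧ ∀ k ≤ n, ∀ q' ∈ π.state k, q' ∈ D := by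
    simp only [← Nat.lt_succ_iff (n := n), ← Nat.lt_succ_iff (n := n + 1), Nat.succ_eq_add_one]
    rw [Nat.forall_lt_succ_left]
    simp [state_cons_zero, state_cons_succ]
  have h2 : (∀ k < n + 1, ∀ t' ∈ (cons q t π).time k, t' ∈ Δ) ↔
      t ∈ Δ ∧ ∀ k < n, ∀ t' ∈ π.time k, t' ∈ Δ := by
    rw [Nat.forall_lt_succ_left]
    simp [time_cons_succ, time_cons_zero]
  change (_ ∧ _) ↔ (_ ∧ _ ∧ _ ∧ _)
  rw [h1, h2]
  tauto

lemma cons_mem_iInter_safe (q : Q) (t : T) (π : TimedPath Q T) (D : Set Q) (Δ : Set T) :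
    cons q t π ∈ ⋂ n, safe D Δ n ↔ q ∈ D ∧ t ∈ Δ ∧ π ∈ ⋂ n, safe D Δ n := by
  have h : ⋂ n, safe D Δ (n + 1) = ⋂ n, safe D Δ n := (safe_antitone D Δ).iInter_nat_add 1
  conv_lhs => rw [← h]
  simp only [Set.mem_iInter, cons_mem_safe_succ, forall_and, forall_const]

variable [MeasurableSpace T]

lemma measurableSet_cylinder (x : ℕ → Q) {R : ℕ → Set T} (hR : ∀ i, MeasurableSet (R i)) (n : ℕ) :
    MeasurableSet (cylinder x R n) :=
  MeasurableSpace.measurableSet_generateFrom ⟨x, R, n, hR, rfl⟩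

lemma measurable_cons (q : Q) :
    Measurable fun p : T × TimedPath Q T => cons q p.1 p.2 := by
  refine measurable_generateFrom ?_
  rintro _ ⟨x, R, n, hR, rfl⟩
  cases n with
  | zero =>
    have : (fun p : T × TimedPath Q T => cons q p.1 p.2) ⁻¹' cylinder x R 0 = {_p | q = x 0} := by
      ext p; simp [cylinder, cons]
    rw [this]
    exact MeasurableSet.const _
  | succ n =>
    have : (fun p : T × TimedPath Q T => cons q p.1 p.2) ⁻¹' cylinder x R (n + 1) =
        {_p | q = x 0} ∩ R 0 ×ˢ cylinder (fun i => x (i + 1)) (fun i => R (i + 1)) n := by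
      ext p
      exact cons_mem_cylinder_succ _ _ _ _ _ _
    rw [this]
    exact (MeasurableSet.const _).inter
      ((hR 0).prod (measurableSet_cylinder _ (fun i => hR (i + 1)) n))

/-- A condition on the `k`-th step is measurable, as the event is a finite union of cylinders:
one for every choice of the first `k + 2` states. -/
lemma measurableSet_step_mem [Finite Q] (k : ℕ) {B : Set T} (hB : MeasurableSet B) (D : Set Q) :
    MeasurableSet {π : TimedPath Q T | ∃ e ∈ π.steps.get? k, e.1 ∈ B ∧ e.2 ∈ D} := by
  classical
  have : {π : TimedPath Q T | ∃ e ∈ π.steps.get? k, e.1 ∈ B ∧ e.2 ∈ D} =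
      ⋃ x : {x : Fin (k + 2) → Q // x (Fin.last _) ∈ D},
        cylinder (fun i => x.1 (Fin.ofNat (k + 2) i)) (fun i => if i = k then B else Set.univ)
          (k + 1) := by
    ext π
    simp only [Set.mem_iUnion, Subtype.exists]
    constructor
    · rintro ⟨e, he, heB, heD⟩
      have hst : ∀ i ≤ k, ∃ e', π.steps.get? i = some e' := fun i hi => by
        obtain ⟨e', h'⟩ := π.steps.ge_stable hi he
        exact ⟨e', h'⟩
      have hs : ∀ i : Fin (k + 2), ∃ q, π.state i = some q := by
        rintro ⟨i, hi⟩
        cases i with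
        | zero => exact ⟨_, rfl⟩
        | succ i =>
          obtain ⟨e', h'⟩ := hst i (by omega)
          exact ⟨e'.2, by simp [state, h']⟩
      choose x hx using hs
      have hof : ∀ i (hi : i < k + 2), Fin.ofNat (k + 2) i = ⟨i, hi⟩ := fun i hi =>
        Fin.ext (Nat.mod_eq_of_lt hi)
      refine ⟨x, ?_, ?_, fun i hi => ?_⟩
      · have := hx (Fin.last _)
        have he' : π.steps.get? k = some e := he
        simp only [Fin.val_last, state, he', Option.map_some, Option.some.injEq] at this
        rwa [← this]
      · have := hx 0
        simpa [state] using this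
      · obtain ⟨e', h'⟩ := hst i (by omega)
        have hi' := hx ⟨i + 1, by omega⟩
        simp only [state, h', Option.map_some, Option.some.injEq] at hi'
        refine ⟨e'.1, ?_, ?_⟩
        · by_cases hik : i = k
          · subst hik
            rw [Option.mem_def.1 he, Option.some.injEq] at h'
            simpa [← h'] using heB
          · simp [hik]
        · simp only [h', hof (i + 1) (by omega), ← hi']
    · rintro ⟨x, hx, -, h⟩
      obtain ⟨t, ht, h'⟩ := h k (by omega)
      refine ⟨_, h', by simpa using ht, ?_⟩
      have hlast : Fin.ofNat (k + 2) (k + 1) = Fin.last _ :=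
        Fin.ext (Nat.mod_eq_of_lt (Nat.lt_succ_self _))
      simpa only [hlast] using hx
  rw [this]
  exact MeasurableSet.iUnion fun x => measurableSet_cylinder _
    (fun i => by split_ifs; exacts [hB, MeasurableSet.univ]) _

lemma measurableSet_safe [Finite Q] (D : Set Q) {Δ : Set T} (hΔ : MeasurableSet Δ) (n : ℕ) :
    MeasurableSet (safe D Δ n) := by
  have hstart : ∀ q : Q, MeasurableSet {π : TimedPath Q T | π.start = q} := fun q => by
    convert measurableSet_cylinder (fun _ => q) (fun _ => MeasurableSet.univ (α := T)) 0
    simp [cylinder]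
  have h1 : ∀ k, MeasurableSet {π : TimedPath Q T | ∀ q ∈ π.state k, q ∈ D} := fun k => by
    cases k with
    | zero =>
      have : {π : TimedPath Q T | ∀ q ∈ π.state 0, q ∈ D} =
          ⋃ q : D, {π : TimedPath Q T | π.start = q} := by
        ext π; simp [state]
      rw [this]
      exact MeasurableSet.iUnion fun q => hstart q
    | succ k =>
      have := (measurableSet_step_mem (T := T) k MeasurableSet.univ Dᶜ).compl
      convert this using 1
      ext π
      rcases h : π.steps.get? k with _ | ⟨t, q⟩ <;> simp [state, h]
  have h2 : ∀ k, MeasurableSet {π : TimedPath Q T | ∀ t ∈ π.time k, t ∈ Δ} := fun k => by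
    have := (measurableSet_step_mem (Q := Q) k hΔ.compl Set.univ).compl
    convert this using 1
    ext π
    rcases h : π.steps.get? k with _ | ⟨t, q⟩ <;> simp [time, h]
  have : safe D Δ n = (⋂ k, ⋂ (_ : k ≤ n), {π : TimedPath Q T | ∀ q ∈ π.state k, q ∈ D}) ∩
      ⋂ k, ⋂ (_ : k < n), {π : TimedPath Q T | ∀ t ∈ π.time k, t ∈ Δ} := by
    ext π; simp [safe]
  rw [this]
  exact (MeasurableSet.iInter fun k => MeasurableSet.iInter fun _ => h1 k).inter
    (MeasurableSet.iInter fun k => MeasurableSet.iInter fun _ => h2 k)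

end TimedPath

namespace TimedChain

variable {Q T : Type*} [MeasurableSpace T] (K : TimedChain Q T)

instance (q : Q) : IsProbabilityMeasure (K.pathMeasure q) :=
  (K.isPathMeasure_pathMeasure q).isProbabilityMeasure

/-- From an absorbing state, the path ends immediately. -/
lemma pathMeasure_of_mem {q : Q} (h : q ∈ K.absorbing) :
    K.pathMeasure q = Measure.dirac ⟨q, Stream'.Seq.nil⟩ := by
  classical
  refine (K.isPathMeasure_pathMeasure q).unique ⟨inferInstance, fun x R => ?_, fun x R hR n => ?_⟩
  · rw [TimedPath.cylinder_zero_eq x R fun _ => Set.univ, Measure.dirac_apply' _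
      (TimedPath.measurableSet_cylinder _ (fun _ => MeasurableSet.univ) _)]
    simp [TimedPath.cylinder, Set.indicator_apply, eq_comm]
  · have hn : (⟨q, Stream'.Seq.nil⟩ : TimedPath Q T) ∉ TimedPath.cylinder x R (n + 1) := by
      rintro ⟨-, h⟩
      obtain ⟨t, -, ht⟩ := h n (by omega)
      simp at ht
    rw [Measure.dirac_apply' _ (TimedPath.measurableSet_cylinder _ hR _),
      Set.indicator_of_notMem hn, Measure.dirac_apply' _ (TimedPath.measurableSet_cylinder _ hR _)]
    cases n with
    | zero =>
      by_cases h0 : q = x 0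
      · rw [← h0]; simp [stepProb, h]
      · simp [TimedPath.cylinder, h0]
    | succ n =>
      have hn : (⟨q, Stream'.Seq.nil⟩ : TimedPath Q T) ∉ TimedPath.cylinder x R (n + 1) := by
        rintro ⟨-, h⟩
        obtain ⟨t, -, ht⟩ := h n (by omega)
        simp at ht
      rw [Set.indicator_of_notMem hn, zero_mul]

/-- The Markov property at the first step: the path from a non-absorbing state `q` makes a step
with an independent delay and successor, and then continues as a path from that successor. -/
lemma pathMeasure_of_notMem [Fintype Q] {q : Q} (h : q ∉ K.absorbing) :
    K.pathMeasure q = ∑ y, K.τ ⟨q, h⟩ y •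
      ((K.ρ ⟨q, h⟩ : Measure T).prod (K.pathMeasure y)).map
        fun p => TimedPath.cons q p.1 p.2 := by
  classical
  set ν : Measure (TimedPath Q T) := ∑ y, K.τ ⟨q, h⟩ y •
      ((K.ρ ⟨q, h⟩ : Measure T).prod (K.pathMeasure y)).map
        fun p => TimedPath.cons q p.1 p.2 with hν
  have hτ : ∑ y, K.τ ⟨q, h⟩ y = 1 := by rw [← tsum_fintype (L := .unconditional Q), PMF.tsum_coe]
  have happ : ∀ E : Set (TimedPath Q T), MeasurableSet E → ν E = ∑ y, K.τ ⟨q, h⟩ y *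
      ((K.ρ ⟨q, h⟩ : Measure T).prod (K.pathMeasure y))
        ((fun p => TimedPath.cons q p.1 p.2) ⁻¹' E) := fun E hE => by
    rw [hν, Measure.finsetSum_apply]
    exact Finset.sum_congr rfl fun y _ => by
      rw [Measure.smul_apply, Measure.map_apply (TimedPath.measurable_cons q) hE, smul_eq_mul]
  have hzero : ∀ (x : ℕ → Q) (R : ℕ → Set T),
      ν (TimedPath.cylinder x R 0) = if x 0 = q then 1 else 0 := fun x R => by
    rw [TimedPath.cylinder_zero_eq x R fun _ => Set.univ, happ _
      (TimedPath.measurableSet_cylinder _ (fun _ => MeasurableSet.univ) _)]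
    by_cases h0 : x 0 = q
    · simp [TimedPath.cylinder, TimedPath.cons, h0, hτ]
    · simp [TimedPath.cylinder, TimedPath.cons, h0, Ne.symm h0]
  -- on longer cylinders, only the summand of the second state contributes
  have hsucc : ∀ (x : ℕ → Q) (R : ℕ → Set T), (∀ i, MeasurableSet (R i)) → ∀ n,
      ν (TimedPath.cylinder x R (n + 1)) = if x 0 = q then
        (K.ρ ⟨q, h⟩ : Measure T) (R 0) * K.τ ⟨q, h⟩ (x 1) * K.pathMeasure (x 1)
          (TimedPath.cylinder (fun i => x (i + 1)) (fun i => R (i + 1)) n) else 0 := by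
    intro x R hR n
    have hpre : (fun p : T × TimedPath Q T => TimedPath.cons q p.1 p.2) ⁻¹'
        TimedPath.cylinder x R (n + 1) = {_p | q = x 0} ∩
          R 0 ×ˢ TimedPath.cylinder (fun i => x (i + 1)) (fun i => R (i + 1)) n := by
      ext p
      exact TimedPath.cons_mem_cylinder_succ _ _ _ _ _ _
    rw [happ _ (TimedPath.measurableSet_cylinder _ hR _), hpre]
    by_cases h0 : x 0 = q
    swap
    · simp [h0, Ne.symm h0]
    simp only [h0, if_true, Set.ofPred_true, Set.univ_inter, Measure.prod_prod]
    rw [Finset.sum_eq_single (x 1) _ (by simp)]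
    · ring
    · intro y _ hy
      have h1 := (K.isPathMeasure_pathMeasure y).cylinder_zero (fun i => x (i + 1))
        (fun i => R (i + 1))
      rw [if_neg hy.symm] at h1
      rw [measure_mono_null (fun _ hπ => And.intro hπ.1 (by simp)) h1, mul_zero, mul_zero]
  have huniv : ν Set.univ = 1 := by
    rw [happ _ MeasurableSet.univ]
    simp [hτ]
  refine (K.isPathMeasure_pathMeasure q).unique ⟨⟨huniv⟩, hzero, fun x R hR n => ?_⟩
  rw [hsucc x R hR]
  cases n with
  | zero =>
    rw [hzero, (K.isPathMeasure_pathMeasure (x 1)).cylinder_zero]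
    by_cases h0 : x 0 = q
    · simp [h0, stepProb, h]
    · simp [h0]
  | succ n =>
    rw [hsucc x R hR, (K.isPathMeasure_pathMeasure (x 1)).cylinder_succ _ _ fun i => hR (i + 1)]
    split_ifs
    · rw [mul_assoc _ _ (K.stepProb _ _ _)]
    · rw [zero_mul]

/-- The probability of an event that requires the first delay to lie in `Δ` and the rest of
the path to lie in `F`. -/
lemma pathMeasure_real_of_notMem [Fintype Q] {q : Q} (h : q ∉ K.absorbing)
    {E F : Set (TimedPath Q T)} (hE : MeasurableSet E) {Δ : Set T}
    (hEF : ∀ t π, TimedPath.cons q t π ∈ E ↔ t ∈ Δ ∧ π ∈ F) :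
    (K.pathMeasure q).real E = (K.ρ ⟨q, h⟩ : Measure T).real Δ *
      (K.τ ⟨q, h⟩).expect fun y => (K.pathMeasure y).real F := by
  have hpre : (fun p : T × TimedPath Q T => TimedPath.cons q p.1 p.2) ⁻¹' E = Δ ×ˢ F := by
    ext p
    exact hEF _ _
  have : K.pathMeasure q E = ∑ y, K.τ ⟨q, h⟩ y *
      ((K.ρ ⟨q, h⟩ : Measure T) Δ * K.pathMeasure y F) := by
    rw [pathMeasure_of_notMem K h, Measure.finsetSum_apply]
    refine Finset.sum_congr rfl fun y _ => ?_
    rw [Measure.smul_apply, Measure.map_apply (TimedPath.measurable_cons q) hE, smul_eq_mul, hpre,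
      Measure.prod_prod]
  rw [measureReal_def, this, ENNReal.toReal_sum fun y _ => ENNReal.mul_ne_top
    (PMF.apply_ne_top _ _) (ENNReal.mul_ne_top (measure_ne_top _ _) (measure_ne_top _ _)),
    PMF.expect, Finset.mul_sum]
  refine Finset.sum_congr rfl fun y _ => ?_
  rw [ENNReal.toReal_mul, ENNReal.toReal_mul, measureReal_def, measureReal_def]
  ring

end TimedChain

/-! ### The discrepancy as a least fixed point -/

/-- The discrepancy that results from a step with joint delay law `ν` and joint successor law `ω`
if it is `d` after the step: the probability that the delays differ or, independently of that,
a discrepancy occurs later. -/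
noncomputable def stepLoss {S : Type*} [Fintype S] (ν : ProbabilityMeasure (ℝ≥0 × ℝ≥0))
    (ω : PMF (S × S)) (d : S → S → ℝ) : ℝ :=
  1 - (1 - ν.mismatch) * (1 - ω.expect fun p => d p.1 p.2)

section stepLoss

variable {S : Type*} [Fintype S]

lemma stepLoss_le_stepLoss {ν ν' : ProbabilityMeasure (ℝ≥0 × ℝ≥0)} {ω ω' : PMF (S × S)}
    {d d' : S → S → ℝ} (hν : ν.mismatch ≤ ν'.mismatch) (hd' : ∀ s s', d' s s' ≤ 1)
    (hω : ω.expect (fun p => d p.1 p.2) ≤ ω'.expect fun p => d' p.1 p.2) :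
    stepLoss ν ω d ≤ stepLoss ν' ω' d' := by
  have h1 := ν'.mismatch_le_one
  have h2 := ω'.expect_le_one (f := fun p => d' p.1 p.2) fun p => hd' _ _
  refine sub_le_sub_left (mul_le_mul ?_ ?_ ?_ ?_) 1 <;> linarith

lemma stepLoss_le_one (ν : ProbabilityMeasure (ℝ≥0 × ℝ≥0)) (ω : PMF (S × S)) {d : S → S → ℝ}
    (hd : ∀ s s', d s s' ≤ 1) : stepLoss ν ω d ≤ 1 :=
  sub_le_self 1 (mul_nonneg (sub_nonneg.2 ν.mismatch_le_one)
    (sub_nonneg.2 (ω.expect_le_one fun _ => hd _ _)))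

/-- A step without loss has equal delays almost surely and leads to pairs at distance zero. -/
lemma stepLoss_eq_zero {ν : ProbabilityMeasure (ℝ≥0 × ℝ≥0)} {ω : PMF (S × S)} {d : S → S → ℝ}
    (h0 : ∀ s s', 0 ≤ d s s') (h1 : ∀ s s', d s s' ≤ 1) (h : stepLoss ν ω d = 0) :
    ν.mismatch = 0 ∧ ∀ p ∈ ω.support, d p.1 p.2 = 0 := by
  rw [← PMF.expect_eq_zero_iff ω (f := fun p => d p.1 p.2) fun p => h0 _ _]
  have a0 := ν.mismatch_nonneg
  have a1 := ν.mismatch_le_one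
  have b0 := ω.expect_nonneg (f := fun p => d p.1 p.2) fun p => h0 _ _
  have b1 := ω.expect_le_one (f := fun p => d p.1 p.2) fun p => h1 _ _
  unfold stepLoss at h
  constructor <;> nlinarith

/-- The real-number inequality behind the triangle inequality: with `p = 1 - a` and `q = 1 - b`,
it reads `p₁q₁ + p₂q₂ ≤ 1 + pq`. -/
lemma one_sub_mul_le_add {a b a₁ b₁ a₂ b₂ : ℝ} (ha : a ≤ a₁ + a₂) (hb : b ≤ b₁ + b₂)
    (ha1 : a ≤ 1) (hb1 : b ≤ 1) (ha₁ : 0 ≤ a₁) (ha₁1 : a₁ ≤ 1) (ha₂ : 0 ≤ a₂) (ha₂1 : a₂ ≤ 1)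
    (hb₁ : 0 ≤ b₁) (hb₁1 : b₁ ≤ 1) (hb₂ : 0 ≤ b₂) (hb₂1 : b₂ ≤ 1) :
    1 - (1 - a) * (1 - b) ≤ (1 - (1 - a₁) * (1 - b₁)) + (1 - (1 - a₂) * (1 - b₂)) := by
  have h0 : 0 ≤ (1 - a) * (1 - b) := mul_nonneg (by linarith) (by linarith)
  have p1 : (1 - a₁) * (1 - b₁) ≤ 1 - a₁ := mul_le_of_le_one_right (by linarith) (by linarith)
  have p2 : (1 - a₂) * (1 - b₂) ≤ 1 - a₂ := mul_le_of_le_one_right (by linarith) (by linarith)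
  have q1 : (1 - a₁) * (1 - b₁) ≤ 1 - b₁ := mul_le_of_le_one_left (by linarith) (by linarith)
  have q2 : (1 - a₂) * (1 - b₂) ≤ 1 - b₂ := mul_le_of_le_one_left (by linarith) (by linarith)
  by_cases hA : 1 ≤ a₁ + a₂
  · linarith
  by_cases hB : 1 ≤ b₁ + b₂
  · linarith
  have h : (1 - (a₁ + a₂)) * (1 - (b₁ + b₂)) ≤ (1 - a) * (1 - b) :=
    mul_le_mul (by linarith) (by linarith) (by linarith) (by linarith)
  nlinarith [mul_nonneg ha₁ hb₂, mul_nonneg ha₂ hb₁]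

end stepLoss

lemma Option.map_fst_eq_map_snd_iff {β : Type*} (o : Option (β × β)) :
    o.map Prod.fst = o.map Prod.snd ↔ ∀ t ∈ o, t.1 = t.2 := by
  cases o <;> simp

namespace SMM

variable {S AP : Type*} {M : SMM S AP}

/-- A coupled path decouples into equivalent paths if and only if it only visits pairs of
equivalent states and only has pairs of equal delays: the two components have the same length. -/
lemma pathEquiv_decouple_iff (π : TimedPath (S × S) (ℝ≥0 × ℝ≥0)) :
    M.PathEquiv (decouple π).1 (decouple π).2 ↔
      π ∈ ⋂ n, TimedPath.safe {p | M.StateEquiv p.1 p.2} (Set.diagonal ℝ≥0) n := by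
  have hst1 : ∀ k, (decouple π).1.state k = (π.state k).map Prod.fst := fun k => by
    cases k <;> simp [decouple, TimedPath.state, Function.comp_def]
  have hst2 : ∀ k, (decouple π).2.state k = (π.state k).map Prod.snd := fun k => by
    cases k <;> simp [decouple, TimedPath.state, Function.comp_def]
  have ht1 : ∀ k, (decouple π).1.time k = (π.time k).map Prod.fst := fun k => by
    simp [decouple, TimedPath.time, Function.comp_def]
  have ht2 : ∀ k, (decouple π).2.time k = (π.time k).map Prod.snd := fun k => by
    simp [decouple, TimedPath.time, Function.comp_def]
  have h1 : ∀ k, Option.Rel M.StateEquiv ((decouple π).1.state k) ((decouple π).2.state k) ↔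
      ∀ q ∈ π.state k, M.StateEquiv q.1 q.2 := fun k => by
    rw [hst1, hst2]
    rcases π.state k with _ | q <;> simp
  have h2 : ∀ k, (decouple π).1.time k = (decouple π).2.time k ↔
      ∀ t ∈ π.time k, t.1 = t.2 := fun k => by
    rw [ht1, ht2]
    exact Option.map_fst_eq_map_snd_iff _
  simp only [PathEquiv, h1, h2, Set.mem_iInter, TimedPath.safe, Set.mem_ofPred_eq,
    Set.mem_diagonal_iff]
  exact ⟨fun h n => ⟨fun k _ => (h k).1, fun k _ => (h k).2⟩,
    fun h k => ⟨(h (k + 1)).1 k (by omega), (h (k + 1)).2 k (by omega)⟩⟩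

lemma StateEquiv.symm {s s' : S} (h : M.StateEquiv s s') : M.StateEquiv s' s :=
  ⟨h.1.symm, h.2.symm⟩

lemma StateEquiv.trans {s s' s'' : S} (h : M.StateEquiv s s') (h' : M.StateEquiv s' s'') :
    M.StateEquiv s s'' :=
  ⟨h.1.trans h'.1, h.2.trans h'.2⟩

namespace CouplingModel

variable (C : M.CouplingModel)

lemma notMem_absorbing {s s' : S} (hs : s ∉ M.absorbing) (hs' : s' ∉ M.absorbing) :
    (s, s') ∉ C.chain.absorbing := by
  rintro (h | h)
  exacts [hs h.1, hs' h.2]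

lemma isCoupling_τ (u v : {s // s ∉ M.absorbing}) : (C.τ u v).IsCoupling (M.τ u) (M.τ v) :=
  ⟨C.τ_fst u v, C.τ_snd u v⟩

lemma isCoupling_ρ (u v : {s // s ∉ M.absorbing}) : (C.ρ u v).IsCoupling (M.ρ u) (M.ρ v) :=
  ⟨C.ρ_fst u v, C.ρ_snd u v⟩

lemma discrepancy_nonneg (s s' : S) : 0 ≤ C.discrepancy s s' := measureReal_nonneg

lemma discrepancy_le_one (s s' : S) : C.discrepancy s s' ≤ 1 := measureReal_le_one

lemma discrepancy_eq_one_sub [Finite S] (s s' : S) : C.discrepancy s s' =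
    1 - (C.chain.pathMeasure (s, s')).real
      (⋂ n, TimedPath.safe {p | M.StateEquiv p.1 p.2} (Set.diagonal ℝ≥0) n) := by
  rw [← probReal_compl_eq_one_sub (MeasurableSet.iInter fun n =>
    TimedPath.measurableSet_safe _ measurableSet_diagonal n), discrepancy]
  congr 1
  ext π
  exact not_congr (pathEquiv_decouple_iff π)

lemma discrepancy_of_not_stateEquiv {s s' : S} (h : ¬ M.StateEquiv s s') :
    C.discrepancy s s' = 1 := by
  have h0 := (C.chain.isPathMeasure_pathMeasure (s, s')).cylinder_zero (fun _ => (s, s'))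
    fun _ => Set.univ
  rw [if_pos rfl] at h0
  refine le_antisymm (C.discrepancy_le_one s s') ?_
  rw [← ENNReal.toReal_one, ← h0]
  refine measureReal_mono fun π hπ hequiv => h ?_
  have hstart : π.start = (s, s') := hπ.1
  have := (hequiv 0).1
  simpa [decouple, TimedPath.state, hstart] using this

lemma discrepancy_of_mem [Finite S] {s s' : S} (h : M.StateEquiv s s') (hs : s ∈ M.absorbing) :
    C.discrepancy s s' = 0 := by
  rw [discrepancy_eq_one_sub, TimedChain.pathMeasure_of_mem C.chain (Or.inl ⟨hs, trivial⟩),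
    measureReal_def, Measure.dirac_apply' _ (MeasurableSet.iInter fun n =>
      TimedPath.measurableSet_safe _ measurableSet_diagonal n), Set.indicator_of_mem]
  · simp
  · refine Set.mem_iInter.2 fun n => ⟨fun k _ q hq => ?_, fun k _ t ht => ?_⟩
    · cases k with
      | zero =>
        rw [← Option.some.inj hq]
        exact h
      | succ k => simp [TimedPath.state] at hq
    · simp [TimedPath.time] at ht

/-- The one-step recursion for agreement, in terms of the complementary probabilities. It applies
to agreement at all times (`E = F`) and to agreement within `n + 1` and `n` steps. -/
lemma one_sub_agreement_eq [Fintype S] {s s' : S} (h : M.StateEquiv s s') (hs : s ∉ M.absorbing)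
    (hs' : s' ∉ M.absorbing) {E F : Set (TimedPath (S × S) (ℝ≥0 × ℝ≥0))} (hE : MeasurableSet E)
    (hEF : ∀ q t π, TimedPath.cons q t π ∈ E ↔
      q ∈ {p : S × S | M.StateEquiv p.1 p.2} ∧ t ∈ Set.diagonal ℝ≥0 ∧ π ∈ F) :
    1 - (C.chain.pathMeasure (s, s')).real E = stepLoss (C.ρ ⟨s, hs⟩ ⟨s', hs'⟩)
      (C.τ ⟨s, hs⟩ ⟨s', hs'⟩) fun u v => 1 - (C.chain.pathMeasure (u, v)).real F := by
  rw [TimedChain.pathMeasure_real_of_notMem C.chain (C.notMem_absorbing hs hs') hE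
    (Δ := Set.diagonal ℝ≥0) (F := F) fun t π => (hEF _ _ _).trans (and_iff_right h), stepLoss,
    PMF.expect_one_sub, sub_sub_cancel, ProbabilityMeasure.mismatch,
    probReal_compl_eq_one_sub measurableSet_diagonal, sub_sub_cancel]
  rfl

/-- The discrepancy is a fixed point of the one-step operator. -/
theorem discrepancy_eq_stepLoss [Fintype S] {s s' : S} (h : M.StateEquiv s s')
    (hs : s ∉ M.absorbing) (hs' : s' ∉ M.absorbing) :
    C.discrepancy s s' =
      stepLoss (C.ρ ⟨s, hs⟩ ⟨s', hs'⟩) (C.τ ⟨s, hs⟩ ⟨s', hs'⟩) C.discrepancy := by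
  rw [discrepancy_eq_one_sub, C.one_sub_agreement_eq h hs hs' (MeasurableSet.iInter fun n =>
    TimedPath.measurableSet_safe _ measurableSet_diagonal n)
    fun q t π => TimedPath.cons_mem_iInter_safe _ _ _ _ _]
  congr 1
  ext u v
  rw [discrepancy_eq_one_sub]

/-- The discrepancy is below every pre-fixed point of the one-step operator: this holds by
induction for the probability of a discrepancy within `n` steps, and passes to the limit. -/
theorem discrepancy_le [Fintype S] {d : S → S → ℝ} (h0 : ∀ s s', 0 ≤ d s s')
    (h1 : ∀ s s', d s s' ≤ 1) (hne : ∀ s s', ¬ M.StateEquiv s s' → d s s' = 1)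
    (hstep : ∀ s s' (hs : s ∉ M.absorbing) (hs' : s' ∉ M.absorbing), M.StateEquiv s s' →
      stepLoss (C.ρ ⟨s, hs⟩ ⟨s', hs'⟩) (C.τ ⟨s, hs⟩ ⟨s', hs'⟩) d ≤ d s s') (s s' : S) :
    C.discrepancy s s' ≤ d s s' := by
  by_cases h : M.StateEquiv s s'
  swap
  · rw [hne s s' h]; exact C.discrepancy_le_one s s'
  by_cases hs : s ∈ M.absorbing
  · rw [C.discrepancy_of_mem h hs]; exact h0 s s'
  have hs' : s' ∉ M.absorbing := mt h.2.2 hs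
  let E : ℕ → Set (TimedPath (S × S) (ℝ≥0 × ℝ≥0)) := fun n =>
    TimedPath.safe {p | M.StateEquiv p.1 p.2} (Set.diagonal ℝ≥0) n
  have hE : ∀ n, MeasurableSet (E n) := fun n =>
    TimedPath.measurableSet_safe _ measurableSet_diagonal n
  -- the bound for discrepancies within `n` steps
  have hn : ∀ n u v, 1 - (C.chain.pathMeasure (u, v)).real (E n) ≤ d u v := by
    intro n
    induction n with
    | zero =>
      intro u v
      by_cases huv : M.StateEquiv u v
      swap
      · rw [hne u v huv]
        linarith [measureReal_nonneg (μ := C.chain.pathMeasure (u, v)) (s := E 0)]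
      have hc := (C.chain.isPathMeasure_pathMeasure (u, v)).cylinder_zero (fun _ => (u, v))
        fun _ => Set.univ
      rw [if_pos rfl] at hc
      have : (1 : ℝ) ≤ (C.chain.pathMeasure (u, v)).real (E 0) := by
        rw [← ENNReal.toReal_one, ← hc]
        refine measureReal_mono fun π hπ => ⟨fun k hk q hq => ?_, fun k hk => by omega⟩
        obtain rfl : k = 0 := by omega
        rw [← Option.some.inj hq]
        have hstart : π.start = (u, v) := hπ.1
        rw [hstart]
        exact huv
      linarith [h0 u v]
    | succ n ih =>
      intro u v
      by_cases huv : M.StateEquiv u v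
      swap
      · rw [hne u v huv]
        linarith [measureReal_nonneg (μ := C.chain.pathMeasure (u, v)) (s := E (n + 1))]
      by_cases hu : u ∈ M.absorbing
      · refine le_trans ?_ (h0 u v)
        rw [← C.discrepancy_of_mem huv hu, discrepancy_eq_one_sub]
        exact sub_le_sub_left (measureReal_mono (Set.iInter_subset _ _)) 1
      have hv : v ∉ M.absorbing := mt huv.2.2 hu
      rw [C.one_sub_agreement_eq huv hu hv (hE (n + 1))
        fun q t π => TimedPath.cons_mem_safe_succ _ _ _ _ _ _]
      exact (stepLoss_le_stepLoss le_rfl h1 (PMF.expect_mono _ fun p => ih _ _)).trans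
        (hstep u v hu hv huv)
  have hlim := tendsto_measure_iInter_atTop (μ := C.chain.pathMeasure (s, s'))
    (fun n => (hE n).nullMeasurableSet) (TimedPath.safe_antitone _ _) ⟨0, measure_ne_top _ _⟩
  have hlim' := (ENNReal.tendsto_toReal (measure_ne_top _ _)).comp hlim
  rw [discrepancy_eq_one_sub]
  exact le_of_tendsto (hlim'.const_sub 1) (Filter.Eventually.of_forall fun n => hn n s s')

/-- Couplings can be prescribed independently for every pair of non-absorbing states. -/
lemma exists_forall_of_exists {P : (u v : {s // s ∉ M.absorbing}) →
      ProbabilityMeasure (ℝ≥0 × ℝ≥0) → PMF (S × S) → Prop}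
    (h : ∀ u v, ∃ ν ω, ν.IsCoupling (M.ρ u) (M.ρ v) ∧ ω.IsCoupling (M.τ u) (M.τ v) ∧ P u v ν ω) :
    ∃ C : M.CouplingModel, ∀ u v, P u v (C.ρ u v) (C.τ u v) := by
  choose ν ω hν hω hP using h
  exact ⟨⟨ω, fun u v => (hω u v).fst, fun u v => (hω u v).snd, ν, fun u v => (hν u v).fst,
    fun u v => (hν u v).snd⟩, hP⟩

end CouplingModel

/-! ### Optimal coupling models -/

lemma theta_le_discrepancy (C : M.CouplingModel) (s s' : S) : M.theta s s' ≤ C.discrepancy s s' :=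
  ciInf_le ⟨0, by rintro _ ⟨C, rfl⟩; exact C.discrepancy_nonneg s s'⟩ C

lemma theta_nonneg (M : SMM S AP) (s s' : S) : 0 ≤ M.theta s s' :=
  Real.iInf_nonneg fun C => C.discrepancy_nonneg s s'

/-- Every cost function has a coupling model with minimal one-step loss at all pairs. -/
lemma exists_stepLoss_le [Fintype S] (M : SMM S AP) {d : S → S → ℝ} (h1 : ∀ s s', d s s' ≤ 1) :
    ∃ C : M.CouplingModel, ∀ u v ν ω, ν.IsCoupling (M.ρ u) (M.ρ v) →
      ω.IsCoupling (M.τ u) (M.τ v) → stepLoss (C.ρ u v) (C.τ u v) d ≤ stepLoss ν ω d := by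
  refine CouplingModel.exists_forall_of_exists (P := fun u v ν₀ ω₀ => ∀ ν ω,
    ν.IsCoupling (M.ρ u) (M.ρ v) → ω.IsCoupling (M.τ u) (M.τ v) →
      stepLoss ν₀ ω₀ d ≤ stepLoss ν ω d) fun u v => ?_
  obtain ⟨ν, hν, hνmin⟩ :=
    ProbabilityMeasure.exists_isCoupling_mismatch_isMin (M.ρ u) (M.ρ v)
  obtain ⟨ω, hω, hωmin⟩ :=
    PMF.exists_isCoupling_isMinOn (M.τ u) (M.τ v) fun p => d p.1 p.2
  exact ⟨ν, ω, hν, hω, fun ν' ω' hν' hω' =>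
    stepLoss_le_stepLoss (hνmin ν' hν') h1 (hωmin ω' hω')⟩

instance [Fintype S] (M : SMM S AP) : Nonempty M.CouplingModel :=
  ⟨(M.exists_stepLoss_le (d := fun _ _ => 0) fun _ _ => zero_le_one).choose⟩

lemma theta_le_one [Fintype S] (M : SMM S AP) (s s' : S) : M.theta s s' ≤ 1 :=
  (theta_le_discrepancy (Classical.arbitrary M.CouplingModel) s s').trans
    (CouplingModel.discrepancy_le_one _ s s')

lemma theta_of_not_stateEquiv [Fintype S] {s s' : S} (h : ¬ M.StateEquiv s s') :
    M.theta s s' = 1 := by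
  simp only [theta, CouplingModel.discrepancy_of_not_stateEquiv _ h, ciInf_const]

/-- A single coupling model attains all the minima simultaneously: the one whose couplings
minimize the one-step loss for the cost `ϑ`. Indeed `ϑ` is a pre-fixed point of its one-step
operator, as every discrepancy is a fixed point that lies above `ϑ`. -/
theorem exists_discrepancy_eq_theta [Fintype S] (M : SMM S AP) :
    ∃ C : M.CouplingModel, ∀ s s', C.discrepancy s s' = M.theta s s' := by
  obtain ⟨C, hC⟩ := M.exists_stepLoss_le M.theta_le_one
  refine ⟨C, fun s s' => le_antisymm ?_ (theta_le_discrepancy C s s')⟩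
  refine C.discrepancy_le M.theta_nonneg M.theta_le_one
    (fun _ _ => theta_of_not_stateEquiv) (fun u v hu hv huv => le_ciInf fun C' => ?_) s s'
  rw [C'.discrepancy_eq_stepLoss huv hu hv]
  exact (hC _ _ _ _ (C'.isCoupling_ρ _ _) (C'.isCoupling_τ _ _)).trans
    (stepLoss_le_stepLoss le_rfl (fun _ _ => C'.discrepancy_le_one _ _)
      (PMF.expect_mono _ fun p => theta_le_discrepancy C' _ _))

/-- At a pair of non-absorbing states, `ϑ` is the one-step loss of some coupling. -/
theorem exists_theta_eq_stepLoss [Fintype S] {s s' : S} (h : M.StateEquiv s s')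
    (hs : s ∉ M.absorbing) (hs' : s' ∉ M.absorbing) :
    ∃ ν ω, ν.IsCoupling (M.ρ ⟨s, hs⟩) (M.ρ ⟨s', hs'⟩) ∧
      ω.IsCoupling (M.τ ⟨s, hs⟩) (M.τ ⟨s', hs'⟩) ∧ M.theta s s' = stepLoss ν ω M.theta := by
  obtain ⟨C, hC⟩ := M.exists_discrepancy_eq_theta
  refine ⟨_, _, C.isCoupling_ρ _ _, C.isCoupling_τ _ _, ?_⟩
  have hC' : C.discrepancy = M.theta := funext fun u => funext (hC u)
  rw [← hC']
  exact C.discrepancy_eq_stepLoss h hs hs'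

/-- The induction principle for `ϑ` as a least fixed point: it is below every `d` that dominates,
at each pair, the one-step loss for `d` of some coupling. -/
theorem theta_le [Fintype S] {d : S → S → ℝ} (h0 : ∀ s s', 0 ≤ d s s')
    (h1 : ∀ s s', d s s' ≤ 1) (hne : ∀ s s', ¬ M.StateEquiv s s' → d s s' = 1)
    (hstep : ∀ s s' (hs : s ∉ M.absorbing) (hs' : s' ∉ M.absorbing), M.StateEquiv s s' →
      d s s' < 1 → ∃ ν ω, ν.IsCoupling (M.ρ ⟨s, hs⟩) (M.ρ ⟨s', hs'⟩) ∧
        ω.IsCoupling (M.τ ⟨s, hs⟩) (M.τ ⟨s', hs'⟩) ∧ stepLoss ν ω d ≤ d s s') (s s' : S) :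
    M.theta s s' ≤ d s s' := by
  obtain ⟨C, hC⟩ := M.exists_stepLoss_le h1
  refine (theta_le_discrepancy C s s').trans
    (C.discrepancy_le h0 h1 hne (fun u v hu hv huv => ?_) s s')
  rcases lt_or_ge (d u v) 1 with hlt | hge
  · obtain ⟨ν, ω, hν, hω, h⟩ := hstep u v hu hv huv hlt
    exact (hC _ _ ν ω hν hω).trans h
  · exact (stepLoss_le_one _ _ h1).trans hge

/-! ### The pseudometric axioms and bisimilarity -/

theorem theta_eq_zero_of_bisimilar [Fintype S] {s s' : S} (h : M.Bisimilar s s') :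
    M.theta s s' = 0 := by
  classical
  obtain ⟨R, hR, hss'⟩ := h
  refine le_antisymm ?_ (M.theta_nonneg s s')
  let d : S → S → ℝ := fun u v => if R u v then 0 else 1
  have hd0 : ∀ u v, 0 ≤ d u v := fun u v => by dsimp only [d]; split_ifs <;> norm_num
  have hd1 : ∀ u v, d u v ≤ 1 := fun u v => by dsimp only [d]; split_ifs <;> norm_num
  have key : M.theta s s' ≤ d s s' := by
    refine theta_le hd0 hd1 (fun u v huv => if_neg fun hr => huv (hR u v hr).1)
      (fun u v hu hv _ hlt => ?_) s s'
    have hr : R u v := by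
      by_contra hr
      simp [d, hr] at hlt
    obtain ⟨hρ, hτ⟩ := (hR u v hr).2 hu hv
    obtain ⟨ν, hν, hν0⟩ := ProbabilityMeasure.exists_isCoupling_self (M.ρ ⟨u, hu⟩)
    obtain ⟨ω, hω, hsupp⟩ := PMF.exists_isCoupling_support_subset R _ _ hτ
    refine ⟨ν, ω, hρ ▸ hν, hω, ?_⟩
    have hE : (ω.expect fun p => d p.1 p.2) = 0 :=
      (ω.expect_eq_zero_iff fun p => hd0 _ _).2 fun p hp => if_pos (hsupp p hp)
    rw [stepLoss, hν0, hE]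
    simpa using hd0 u v
  simpa [d, hss'] using key

theorem theta_self [Fintype S] (M : SMM S AP) (s : S) : M.theta s s = 0 := by
  refine theta_eq_zero_of_bisimilar ⟨⊥, ?_, rfl⟩
  rintro s _ rfl
  exact ⟨⟨rfl, Iff.rfl⟩, fun _ _ => ⟨rfl, fun _ _ => rfl⟩⟩

lemma theta_le_swap [Fintype S] (M : SMM S AP) (s s' : S) : M.theta s s' ≤ M.theta s' s := by
  refine theta_le (d := fun u v => M.theta v u) (fun _ _ => M.theta_nonneg _ _)
    (fun _ _ => M.theta_le_one _ _)
    (fun u v h => theta_of_not_stateEquiv fun h' => h h'.symm) (fun u v hu hv huv _ => ?_) s s'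
  obtain ⟨ν, ω, hν, hω, h⟩ := exists_theta_eq_stepLoss huv.symm hv hu
  obtain ⟨ν', hν', e⟩ := ProbabilityMeasure.exists_isCoupling_swap hν
  refine ⟨ν', ω.map Prod.swap, hν', hω.swap, ?_⟩
  rw [h, stepLoss, stepLoss, e, PMF.expect_map]
  rfl

/-- The triangle inequality. The least value `d x z` of `ϑ x y + ϑ y z` over all `y`, cut off
at `1`, is a pre-fixed point, because the couplings of the pairs `(x, y)` and `(y, z)` can be
glued. -/
theorem theta_triangle [Fintype S] (M : SMM S AP) (x y z : S) :
    M.theta x z ≤ M.theta x y + M.theta y z := by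
  have : Nonempty S := ⟨x⟩
  let d : S → S → ℝ := fun u v => min 1 (⨅ y, (M.theta u y + M.theta y v))
  have hd : ∀ u y v, d u v ≤ M.theta u y + M.theta y v := fun u y v =>
    (min_le_right _ _).trans (ciInf_le (Set.finite_range _).bddBelow y)
  have hd1 : ∀ u v, d u v ≤ 1 := fun u v => min_le_left _ _
  refine le_trans (theta_le (d := d)
    (fun u v => le_min zero_le_one (Real.iInf_nonneg fun y =>
      add_nonneg (M.theta_nonneg _ _) (M.theta_nonneg _ _))) hd1 (fun u v huv => ?_)
    (fun u v hu hv huv hlt => ?_) x z) (hd x y z)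
  · refine min_eq_left (le_ciInf fun y => ?_)
    by_cases h : M.StateEquiv u y
    · rw [theta_of_not_stateEquiv fun h' : M.StateEquiv y v => huv (h.trans h')]
      linarith [M.theta_nonneg u y]
    · rw [theta_of_not_stateEquiv h]
      linarith [M.theta_nonneg y v]
  · obtain ⟨y, hy⟩ := exists_eq_ciInf_of_finite (f := fun y => M.theta u y + M.theta y v)
    have hdy : d u v = M.theta u y + M.theta y v := by
      rcases min_lt_iff.1 hlt with h | h
      · exact absurd h (lt_irrefl _)
      · exact (min_eq_right h.le).trans hy.symm
    rw [hdy] at hlt ⊢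
    -- a distance below `1` forces the intermediate state to be equivalent to the outer ones
    have huy : M.StateEquiv u y := by
      by_contra h
      rw [theta_of_not_stateEquiv h] at hlt
      linarith [M.theta_nonneg y v]
    have hyv : M.StateEquiv y v := huy.symm.trans huv
    have hy' : y ∉ M.absorbing := mt huy.2.2 hu
    obtain ⟨ν₁, ω₁, hν₁, hω₁, e₁⟩ := exists_theta_eq_stepLoss huy hu hy'
    obtain ⟨ν₂, ω₂, hν₂, hω₂, e₂⟩ := exists_theta_eq_stepLoss hyv hy' hv
    obtain ⟨ν, hν, hνle⟩ := ProbabilityMeasure.exists_isCoupling_mismatch_le_add hν₁ hν₂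
    obtain ⟨ω, hω, hωle⟩ := PMF.exists_isCoupling_expect_le_add hω₁ hω₂
      (d := fun p => d p.1 p.2) (f := fun p => M.theta p.1 p.2) (g := fun p => M.theta p.1 p.2) hd
    refine ⟨ν, ω, hν, hω, ?_⟩
    rw [e₁, e₂]
    exact one_sub_mul_le_add hνle hωle ν.mismatch_le_one (ω.expect_le_one fun _ => hd1 _ _)
      ν₁.mismatch_nonneg ν₁.mismatch_le_one ν₂.mismatch_nonneg ν₂.mismatch_le_one
      (ω₁.expect_nonneg fun _ => M.theta_nonneg _ _) (ω₁.expect_le_one fun _ => M.theta_le_one _ _)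
      (ω₂.expect_nonneg fun _ => M.theta_nonneg _ _) (ω₂.expect_le_one fun _ => M.theta_le_one _ _)

theorem isPseudometric_theta [Fintype S] (M : SMM S AP) : IsPseudometric M.theta where
  nonneg := M.theta_nonneg
  self := M.theta_self
  symm s s' := le_antisymm (M.theta_le_swap s s') (M.theta_le_swap s' s)
  triangle := M.theta_triangle

/-- Being at distance zero is a bisimulation. -/
theorem bisimilar_of_theta_eq_zero [Fintype S] {s s' : S} (h : M.theta s s' = 0) :
    M.Bisimilar s s' := by
  have hM := M.isPseudometric_theta
  let R : Setoid S :=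
    { r := fun u v => M.theta u v = 0
      iseqv := ⟨hM.self, fun h => (hM.symm _ _).trans h, fun {u v w} h h' =>
        le_antisymm ((hM.triangle u v w).trans (by rw [h, h', add_zero])) (hM.nonneg u w)⟩ }
  refine ⟨R, fun u v huv => ?_, h⟩
  have huv : M.theta u v = 0 := huv
  have hequiv : M.StateEquiv u v := by
    by_contra hne
    rw [theta_of_not_stateEquiv hne] at huv
    exact one_ne_zero huv
  refine ⟨hequiv, fun hu hv => ?_⟩
  obtain ⟨ν, ω, hν, hω, e⟩ := exists_theta_eq_stepLoss hequiv hu hv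
  obtain ⟨hν0, hsupp⟩ := stepLoss_eq_zero M.theta_nonneg M.theta_le_one (e.symm.trans huv)
  refine ⟨hν.eq_of_mismatch_eq_zero hν0, ?_⟩
  rintro _ ⟨w, rfl⟩
  rw [← hω.fst, ← hω.snd, PMF.toOuterMeasure_map_apply, PMF.toOuterMeasure_map_apply]
  -- the coupling is supported on `R`, so both coordinates lie in a class or neither does
  refine PMF.toOuterMeasure_apply_eq_of_inter_support_eq ω (Set.ext fun p => ?_)
  refine and_congr_left fun hp => ?_
  have hR : R p.1 p.2 := hsupp p hp
  exact ⟨fun h => R.trans (R.symm hR) h, fun h => R.trans hR h⟩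

end SMM

theorem mainTheorem10 {S AP : Type*} [Finite S] [Nonempty S] [Countable AP] (M : SMM S AP) :
    (∀ s s' : S, IsLeast (Set.range fun C : M.CouplingModel => C.discrepancy s s')
      (M.theta s s')) ∧
    IsPseudometric M.theta ∧
    ∀ s s' : S, M.theta s s' = 0 ↔ M.Bisimilar s s' := by
  have := Fintype.ofFinite S
  refine ⟨fun s s' => ⟨?_, ?_⟩, M.isPseudometric_theta, fun s s' =>
    ⟨SMM.bisimilar_of_theta_eq_zero, SMM.theta_eq_zero_of_bisimilar⟩⟩
  · obtain ⟨C, hC⟩ := M.exists_discrepancy_eq_theta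
    exact ⟨C, hC s s'⟩
  · rintro _ ⟨C, rfl⟩
    exact SMM.theta_le_discrepancy C s s'
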